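/- **Conventions.** Spinor indices are moved with $\epsilon^{12}=1$: $a^{\alpha}=\epsilon^{\alpha\beta}a_\beta$, $\langle a\,b\rangle=a^\alpha b_\alpha$, $[a\,b]=a^{\dot\alpha}b_{\dot\alpha}$. Fix spinors $\kappa_1,\kappa_2$ with $\langle\kappa_1\,\kappa_2\rangle=1$, write $\lambda=\lambda_1\kappa_1+\lambda_2\kappa_2$, $\mathrm D\lambda=\langle\lambda\,\mathrm d\lambda\rangle$, $\mathrm D\bar\lambda=[\bar\lambda\,\mathrm d\bar\lambda]$, give $\mathbb P^1$ its complex orientation, and let $\hbar\in\mathbb C\setminus\{0\}$. Let $T$ be an open region, invariant under scaling, of the space of $(\mu^{\dot\alpha},\lambda_\alpha)$ with $\lambda\ne0$. A *Hamiltonian* on $T$ is a smooth $\mathcal O(2)$-valued $(0,1)$-form on $T$ proportional to $\mathrm D\bar\lambda$ and holomorphic in $\mu$ (as is the case for self-dual radiative data). Let $U$ be a connected open set of points $x=(z^{\dot\alpha},\tilde z^{\dot\alpha})\in\mathbb C^2\times\mathbb C^2$. A *family of twistor curves* for a Hamiltonian $H$ is a map $F^{\dot\alpha}(x,\lambda)$,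 smooth on $U\times(\mathbb C^2\setminus 0)$, holomorphic in $x$, of weight $1$ in $\lambda$, with $(F(x,\lambda),\lambda)\in T$ and $$\bar\partial|_xF^{\dot\alpha}=\frac{\partial H}{\partial\mu_{\dot\alpha}}\Big|_{\mu=F},\qquad \mu^{\dot\alpha}=\epsilon^{\dot\alpha\dot\beta}\mu_{\dot\beta}.$$ If $F(x,\kappa_1)=z$ and $F(x,\kappa_2)=\tilde z$, a *Kähler (first Plebanski) potential* of the space-time of these curves is a holomorphic function $\Omega$ on $U$ such that * $\partial\Omega/\partial z^{\dot\alpha}=\partial_{\lambda_2}F_{\dot\alpha}|_{\lambda=\kappa_1}$ and $\partial\Omega/\partial\tilde z^{\dot\alpha}=-\partial_{\lambda_1}F_{\dot\alpha}|_{\lambda=\kappa_2}$ (that is, $F^{\dot\alpha}=\lambda_1z^{\dot\alpha}+\lambda_2\Omega^{\dot\alpha}+\cdots$ at $\kappa_1$ and $F^{\dot\alpha}=\lambda_2\tilde z^{\dot\alpha}-\lambda_1\tilde\Omega^{\dot\alpha}+\cdots$ at $\kappa_2$, with $\Omega_{\dot\alpha}=\partial\Omega/\partial z^{\dot\alpha}$,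 $\tilde\Omega_{\dot\alpha}=\partial\Omega/\partial\tilde z^{\dot\alpha}$); * $\mathrm d_xF^{\dot\alpha}\wedge\mathrm d_xF_{\dot\alpha}=\lambda_1^2\,\mathrm dz^{\dot\alpha}\wedge\mathrm dz_{\dot\alpha}+2\lambda_1\lambda_2\,\frac{\partial^2\Omega}{\partial z^{\dot\alpha}\partial\tilde z^{\dot\beta}}\,\mathrm dz^{\dot\alpha}\wedge\mathrm d\tilde z^{\dot\beta}+\lambda_2^2\,\mathrm d\tilde z^{\dot\alpha}\wedge\mathrm d\tilde z_{\dot\alpha}$; * $\det\big(\partial^2\Omega/\partial z^{\dot\alpha}\partial\tilde z^{\dot\beta}\big)=1$. **Proposition.** Let $\mathsf h$ (background) and $h$ (finite perturbation) be Hamiltonians on $T$. Let $\mathsf F$ be a family of twistor curves for $\mathsf h$ with $\mathsf F(x,\kappa_1)=z$ and $\mathsf F(x,\kappa_2)=\tilde z$, and let $K$ be a Kähler potential of its space-time. Let $F=\mathsf F+m$ be a family of twistor curves for $\mathsf h+h$ with the same values at $\kappa_1$ and $\kappa_2$, in the sense that $m=\lambda_1\lambda_2M$ with $M$ smooth on $U\times(\mathbb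 C^2\setminus0)$. With $X:\mu=F(x,\lambda)$ and $\mathsf X:\mu=\mathsf F(x,\lambda)$, assume that the integral $$S_\Omega[m](x)=\frac1\hbar\int_{\mathbb P^1}\frac{\mathrm D\lambda}{\lambda_1^2\lambda_2^2}\Big([m\;\bar\partial|_xm]+2h|_X+2\Big(\mathsf h|_X-\mathsf h|_{\mathsf X}-\frac{\partial\mathsf h}{\partial\mu^{\dot\alpha}}\Big|_{\mathsf X}m^{\dot\alpha}\Big)\Big)$$ converges absolutely for every $x\in U$. Then $$\Omega=K-\frac{\hbar}{4\pi i}\,S_\Omega[m]$$ is a Kähler potential of the deformed space-time, the one of the curves $F$. It satisfies $\partial\Omega/\partial z^{\dot\alpha}=\partial K/\partial z^{\dot\alpha}+M_{\dot\alpha}(x,\kappa_1)$ and $\partial\Omega/\partial\tilde z^{\dot\alpha}=\partial K/\partial\tilde z^{\dot\alpha}-M_{\dot\alpha}(x,\kappa_2)$, and every Kähler potential of the deformed space-time differs from it by an additive constant. -/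

import Mathlib

open scoped ContDiff

noncomputable section

namespace TwistorSigma

open Complex MeasureTheory

/-- Two-component spinors. The index values `1, 2` are `0, 1 : Fin 2` here. -/
abbrev Spinor : Type := Fin 2 → ℂ

/-- Points of (a region of) the complex space-time, in the coordinates `x = (z, z̃)`. -/
abbrev Point : Type := Spinor × Spinor

/-- `⟨a b⟩ = ε^{αβ} a_β b_α`, for spinors with lower indices, with `ε^{12} = 1`. -/
def angle (a b : Spinor) : ℂ := a 1 * b 0 - a 0 * b 1

/-- Raising an index: `a^α = ε^{αβ} a_β`. -/
def raise (a : Spinor) : Spinor := ![a 1, -a 0]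

/-- Lowering an index, the inverse of `raise`. -/
def lower (a : Spinor) : Spinor := ![-a 1, a 0]

theorem raise_lower (a : Spinor) : raise (lower a) = a := by
  ext i; fin_cases i <;> simp [raise, lower]

theorem lower_raise (a : Spinor) : lower (raise a) = a := by
  ext i; fin_cases i <;> simp [raise, lower]

/-- `[a b] = a^α b_α`, for spinors `a^α`, `b^α` given by their upper components. -/
def square (a b : Spinor) : ℂ := ∑ α, a α * lower b α

/-- The value at `λ = l` on the tangent vector `v` of the `(0,1)`-form `∂̄f`. -/
def dbar (f : Spinor → ℂ) (l v : Spinor) : ℂ :=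
  (fderiv ℝ f l v + I * fderiv ℝ f l (I • v)) / 2

/-- The value at `λ = l` on the tangent vector `v` of the `(1,0)`-form `∂f`. -/
def del (f : Spinor → ℂ) (l v : Spinor) : ℂ :=
  (fderiv ℝ f l v - I * fderiv ℝ f l (I • v)) / 2

/-- The value at `λ = l` on the tangent vector `v` of the `(0,1)`-form `Dλ̄ = [λ̄ dλ̄]`. -/
def barD (l v : Spinor) : ℂ := starRingEnd ℂ (angle l v)

/-- `∂f/∂μ^α`. -/
def dMuUp (f : Spinor → ℂ) (μ : Spinor) (α : Fin 2) : ℂ :=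
  fderiv ℂ f μ (Pi.single α 1)

/-- `∂f/∂μ_α`, the derivative with respect to the lowered coordinate `μ_α`, where
`μ^β = ε^{βα} μ_α`. -/
def dMuLow (f : Spinor → ℂ) (μ : Spinor) (α : Fin 2) : ℂ :=
  fderiv ℂ f μ (raise (Pi.single α 1))

/-- `∂f/∂z^α`. -/
def dZ (f : Point → ℂ) (x : Point) (α : Fin 2) : ℂ :=
  fderiv ℂ f x (Pi.single α 1, 0)

/-- `∂f/∂z̃^α`. -/
def dZt (f : Point → ℂ) (x : Point) (α : Fin 2) : ℂ :=
  fderiv ℂ f x (0, Pi.single α 1)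

/-- An open region of twistor space, described by the corresponding cone in the homogeneous
coordinates `(μ, λ)`, `λ ≠ 0`. -/
structure IsTwistorRegion (T : Set (Spinor × Spinor)) : Prop where
  isOpen : IsOpen T
  ne_zero : ∀ p ∈ T, p.2 ≠ 0
  smul_mem : ∀ p ∈ T, ∀ b : ℂ, b ≠ 0 → b • p ∈ T

/-- `h Dλ̄` is a smooth `𝒪(2)`-valued `(0,1)`-form on the twistor region `T`, proportional to `Dλ̄`
and holomorphic in `μ`. As `Dλ̄` scales with `b̄²`, the coefficient `h` scales with `b² b̄⁻²`. Such a
form satisfies `∂̄h + ½{h, h} = 0`. -/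
structure IsHamiltonian (T : Set (Spinor × Spinor)) (h : Spinor → Spinor → ℂ) : Prop where
  smooth : ContDiffOn ℝ ∞ (fun p : Spinor × Spinor => h p.1 p.2) T
  holo : ∀ p ∈ T, DifferentiableAt ℂ (fun μ => h μ p.2) p.1
  weight : ∀ p ∈ T, ∀ b : ℂ, b ≠ 0 →
    h (b • p.1) (b • p.2) = b ^ 2 / (starRingEnd ℂ b) ^ 2 * h p.1 p.2

/-- A family over `U` of twistor curves `μ^α = F^α(x, λ)` in `T`, of weight one in `λ`, holomorphic
for the complex structure with Hamiltonian `h Dλ̄`: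
`∂̄F^α = ∂h/∂μ_α Dλ̄` on the curve. -/
structure IsCurveFamily (U : Set Point) (T : Set (Spinor × Spinor)) (h : Spinor → Spinor → ℂ)
    (F : Point → Spinor → Spinor) : Prop where
  smooth : ContDiffOn ℝ ∞ (fun p : Point × Spinor => F p.1 p.2) (U ×ˢ {0}ᶜ)
  holo : ∀ x ∈ U, ∀ l : Spinor, l ≠ 0 → DifferentiableAt ℂ (fun y => F y l) x
  weight : ∀ x ∈ U, ∀ l : Spinor, l ≠ 0 → ∀ b : ℂ, b ≠ 0 → F x (b • l) = b • F x l
  mem : ∀ x ∈ U, ∀ l : Spinor, l ≠ 0 → (F x l, l) ∈ T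
  curve : ∀ x ∈ U, ∀ l : Spinor, l ≠ 0 → ∀ (v : Spinor) (α : Fin 2),
    dbar (fun l' => F x l' α) l v = dMuLow (fun μ => h μ l) (F x l) α * barD l v

/-- The value of `ω^α ∧ ω_α` on a pair of vectors `u`, `v` with `ω^α(u) = p^α`, `ω^α(v) = q^α`. -/
def wedgeSelf (p q : Spinor) : ℂ := ∑ α, (p α * lower q α - q α * lower p α)

/-- The value of the 2-form `Σ(x, λ) = d_x F^α ∧ d_x F_α` on tangent vectors `u`, `v`. -/
def sigmaForm (F : Point → Spinor → Spinor) (x : Point) (l : Spinor) (u v : Point) : ℂ :=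
  wedgeSelf (fderiv ℂ (fun y => F y l) x u) (fderiv ℂ (fun y => F y l) x v)

/-- `∂²K/∂z^α∂z̃^β`. -/
def mixedHessian (K : Point → ℂ) (x : Point) : Matrix (Fin 2) (Fin 2) ℂ :=
  Matrix.of fun α β => dZt (fun y => dZ K y α) x β

/-- The coordinates of `λ = λ₁ κ₁ + λ₂ κ₂` for a spinor basis with `⟨κ₁ κ₂⟩ = 1`. -/
def lam1 (κ₂ l : Spinor) : ℂ := angle l κ₂

/-- See `lam1`. -/
def lam2 (κ₁ l : Spinor) : ℂ := angle κ₁ l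

/-- `K` is a Kähler potential, in first Plebanski form, of the space-time whose points are the curves
`μ^α = F^α(x, λ)`, with `z^α = F^α(x, κ₁)` and `z̃^α = F^α(x, κ₂)`. Namely `K` is holomorphic,
its derivatives are the next coefficients of the curves,
`F^α = λ₁ z^α + λ₂ K^α + ⋯` at `κ₁`, with `K_α = ∂K/∂z^α`, and
`F^α = λ₂ z̃^α - λ₁ K̃^α + ⋯` at `κ₂`, with `K̃_α = ∂K/∂z̃^α`;
the ASD 2-forms of the space-time, read off from
`d_x F^α ∧ d_x F_α = λ₁² Σ¹¹ + 2 λ₁ λ₂ Σ¹² + λ₂² Σ²²`, are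
`Σ¹¹ = dz^α ∧ dz_α`, `Σ¹² = (∂²K/∂z^α∂z̃^β) dz^α ∧ dz̃^β`, `Σ²² = dz̃^α ∧ dz̃_α`;
and `K` solves the first heavenly equation. -/
structure IsKahlerPotential (U : Set Point) (κ₁ κ₂ : Spinor) (F : Point → Spinor → Spinor)
    (K : Point → ℂ) : Prop where
  holo : DifferentiableOn ℂ K U
  deriv_z : ∀ x ∈ U, ∀ α, dZ K x α = lower (fun β => del (fun l => F x l β) κ₁ κ₂) α
  deriv_zt : ∀ x ∈ U, ∀ α, dZt K x α = -lower (fun β => del (fun l => F x l β) κ₂ κ₁) α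
  twoForms : ∀ x ∈ U, ∀ l : Spinor, l ≠ 0 → ∀ u v : Point,
    sigmaForm F x l u v =
      lam1 κ₂ l ^ 2 * wedgeSelf u.1 v.1
      + 2 * lam1 κ₂ l * lam2 κ₁ l *
        ∑ α, ∑ β, mixedHessian K x α β * (u.1 α * v.2 β - v.1 α * u.2 β)
      + lam2 κ₁ l ^ 2 * wedgeSelf u.2 v.2
  heavenly : ∀ x ∈ U, (mixedHessian K x).det = 1

/-- The value at `λ = l` on the tangent vector `v` of the `(0,1)`-form
`λ₁⁻² λ₂⁻² ([m ∂̄m] + 2 h|_X + 2 (hb|_X - hb|_Xb - (∂hb/∂μ^α)|_Xb m^α))`,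
where `Xb` is the background curve `μ = Fb(λ)` and `X` the curve `μ = Fb(λ) + m(λ)`. -/
def lagrangian (κ₁ κ₂ : Spinor) (hb h : Spinor → Spinor → ℂ) (Fb m : Spinor → Spinor)
    (l v : Spinor) : ℂ :=
  (square (m l) (fun α => dbar (fun l' => m l' α) l v)
    + 2 * (h (Fb l + m l) l * barD l v)
    + 2 * ((hb (Fb l + m l) l - hb (Fb l) l
        - ∑ α, dMuUp (fun μ => hb μ l) (Fb l) α * m l α) * barD l v))
  / (lam1 κ₂ l ^ 2 * lam2 κ₁ l ^ 2)

/-- The density in the affine coordinate `w` of the integral over `ℙ¹` of `Dλ ∧ θ`, for a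
`(0,1)`-form `θ` of weight `-2`. On `λ = κ₁ + w κ₂` with `⟨κ₁ κ₂⟩ = 1` one has `Dλ = dw`,
`θ = θ(κ₂) dw̄`, and `dw ∧ dw̄ = -2i d(Re w) ∧ d(Im w)`. -/
def affineDensity (κ₁ κ₂ : Spinor) (θ : Spinor → Spinor → ℂ) (w : ℂ) : ℂ :=
  -2 * I * θ (κ₁ + w • κ₂) κ₂

/-- The integral over `ℙ¹`, with its complex orientation, of `Dλ ∧ θ`. -/
def integralP1 (κ₁ κ₂ : Spinor) (θ : Spinor → Spinor → ℂ) : ℂ :=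
  ∫ w : ℂ, affineDensity κ₁ κ₂ θ w

/-- The action `S_Ω[m]` of the chiral twistor sigma model coupled to the background. -/
def action (κ₁ κ₂ : Spinor) (hbar : ℂ) (hb h : Spinor → Spinor → ℂ) (Fb m : Spinor → Spinor) : ℂ :=
  1 / hbar * integralP1 κ₁ κ₂ (lagrangian κ₁ κ₂ hb h Fb m)

end TwistorSigma

end

/-!
The Kähler potential of the deformed space-time is governed by a first-variation formula. Write `X`
for the curves `F` of `hb + h` and `δ_u` for the derivative along a space-time vector `u`. By the
curve equations, the numerator of the Lagrangian is `[m ∂̄(F + Fb)] + 2 ((hb + h)|_X - hb|_Xb) Dλ̄`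
(`IsDeformation.lagrangian_eq`), and its derivative along `u` is the total derivative
`∂̄[m δ_u(F + Fb)]` (`IsDeformation.fderiv_affineDensity`). Dividing by `λ₁² λ₂²`, the variation of
the action is the integral of `Dλ ∧ ∂̄g / (λ₁ λ₂)` for the smooth function `g = [M δ_u(F + Fb)]` of
weight zero, and the Cauchy-Pompeiu formula (`integral_dbar_div`, `integral_dbar_affine`) evaluates
it as `2πi (g(κ₁) - g(κ₂))`. As `δ_u F` is the prescribed component of `u` at `κ₁` and `κ₂`,
this gives the derivatives of `Ω` (`IsDeformation.fderiv_action`).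

Differentiation under the integral sign needs only a local bound on the varied integrand. It comes
from the same formula: as `g` is smooth on the compact `ℙ¹`, its derivatives in the affine coordinate
decay as `|w|⁻²`, uniformly in `x` (`exists_bound_fderiv_affine`), and `|w|⁻¹ (1 + |w|)⁻²` is
integrable on the plane.

The derivatives of `Ω` are the next coefficients of the curves `F` at `κ₁` and `κ₂`. The rest of the
structure follows from this (`IsCurveFamily.isKahlerPotential`). The form `[δ_u F δ_v F]` is
holomorphic in `λ`, because the symmetry of the second `x`-derivatives of the Hamiltonian along the
curves makes its `∂̄` vanish (`IsCurveFamily.dbar_square_variation`). Having weight two, it is a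
quadratic polynomial in `λ` by Liouville's theorem (`eq_quadratic_of_weight_two`); the outer
coefficients are its values at `κ₁` and `κ₂`, and the middle one is the mixed Hessian of `Ω`. At
`λ = κ₁ + κ₂` the Plücker relation for this decomposable form is the first heavenly equation.
-/

noncomputable section

namespace TwistorSigma

open Complex MeasureTheory Filter Topology Set

/-! ### Spinor algebra -/

theorem square_eq (a b : Spinor) : square a b = a 1 * b 0 - a 0 * b 1 := by
  simp [square, lower]; ring

theorem lam_decomp {κ₁ κ₂ : Spinor} (hκ : angle κ₁ κ₂ = 1) (l : Spinor) :
    l = lam1 κ₂ l • κ₁ + lam2 κ₁ l • κ₂ := by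
  unfold angle at hκ
  ext i
  fin_cases i
  · simp [lam1, lam2, angle]; linear_combination (-l 0) * hκ
  · simp [lam1, lam2, angle]; linear_combination (-l 1) * hκ

theorem lam1_affine {κ₁ κ₂ : Spinor} (hκ : angle κ₁ κ₂ = 1) (a b : ℂ) :
    lam1 κ₂ (a • κ₁ + b • κ₂) = a := by
  unfold angle at hκ
  simp [lam1, angle]; linear_combination a * hκ

theorem lam2_affine {κ₁ κ₂ : Spinor} (hκ : angle κ₁ κ₂ = 1) (a b : ℂ) :
    lam2 κ₁ (a • κ₁ + b • κ₂) = b := by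
  unfold angle at hκ
  simp [lam2, angle]; linear_combination b * hκ

theorem lam1_zero (κ₂ : Spinor) : lam1 κ₂ 0 = 0 := by simp [lam1, angle]

theorem lam2_zero (κ₁ : Spinor) : lam2 κ₁ 0 = 0 := by simp [lam2, angle]

theorem lam1_smul (κ₂ : Spinor) (b : ℂ) (l : Spinor) : lam1 κ₂ (b • l) = b * lam1 κ₂ l := by
  simp [lam1, angle]; ring

theorem lam2_smul (κ₁ : Spinor) (b : ℂ) (l : Spinor) : lam2 κ₁ (b • l) = b * lam2 κ₁ l := by
  simp [lam2, angle]; ring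

theorem ne_zero_of_angle_left {a b : Spinor} (h : angle a b = 1) : a ≠ 0 := by
  rintro rfl; simp [angle] at h

theorem ne_zero_of_angle_right {a b : Spinor} (h : angle a b = 1) : b ≠ 0 := by
  rintro rfl; simp [angle] at h

theorem add_smul_ne_zero {κ₁ κ₂ : Spinor} (hκ : angle κ₁ κ₂ = 1) (w : ℂ) :
    κ₁ + w • κ₂ ≠ 0 := by
  intro h
  have := lam1_affine hκ 1 w
  rw [one_smul, h, lam1_zero] at this
  exact zero_ne_one this

theorem smul_add_ne_zero {κ₁ κ₂ : Spinor} (hκ : angle κ₁ κ₂ = 1) (w : ℂ) :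
    w • κ₁ + κ₂ ≠ 0 := by
  intro h
  have := lam2_affine hκ w 1
  rw [one_smul, h, lam2_zero] at this
  exact zero_ne_one this

theorem differentiable_lam1 (κ₂ : Spinor) : Differentiable ℂ (lam1 κ₂) := by
  unfold lam1 angle; fun_prop

theorem differentiable_lam2 (κ₁ : Spinor) : Differentiable ℂ (lam2 κ₁) := by
  unfold lam2 angle; fun_prop

theorem fderiv_lam1 (κ₂ l v : Spinor) : fderiv ℂ (lam1 κ₂) l v = lam1 κ₂ v := by
  have h : IsBoundedLinearMap ℂ (lam1 κ₂) :=
    (IsLinearMap.mk (fun a b => by simp [lam1, angle]; ring) (fun c a => by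
      simp [lam1, angle]; ring) :
        IsLinearMap ℂ (lam1 κ₂)).mk'.toContinuousLinearMap.isBoundedLinearMap
  rw [h.fderiv]; rfl

theorem fderiv_lam2 (κ₁ l v : Spinor) : fderiv ℂ (lam2 κ₁) l v = lam2 κ₁ v := by
  have h : IsBoundedLinearMap ℂ (lam2 κ₁) :=
    (IsLinearMap.mk (fun a b => by simp [lam2, angle]; ring) (fun c a => by
      simp [lam2, angle]; ring) :
        IsLinearMap ℂ (lam2 κ₁)).mk'.toContinuousLinearMap.isBoundedLinearMap
  rw [h.fderiv]; rfl

/-! ### Wirtinger derivatives -/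

/-- The Wirtinger derivatives of `f` on the tangent vector `v`: the one for `s = I` is `dbar`, the
one for `s = -I` is `del`. Both obey the Leibniz rule and commute with derivatives along
parameters, so the two are treated together. -/
def wirtinger (s : ℂ) (f : Spinor → ℂ) (l v : Spinor) : ℂ :=
  (fderiv ℝ f l v + s * fderiv ℝ f l (I • v)) / 2

theorem dbar_eq_wirtinger : dbar = wirtinger I := rfl

theorem del_eq_wirtinger : del = wirtinger (-I) := by
  ext f l v; simp only [del, wirtinger]; ring

theorem wirtinger_congr {s : ℂ} {f g : Spinor → ℂ} {l : Spinor} (h : f =ᶠ[𝓝 l] g) (v : Spinor) :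
    wirtinger s f l v = wirtinger s g l v := by
  simp only [wirtinger, h.fderiv_eq]

theorem wirtinger_add {s : ℂ} {f g : Spinor → ℂ} {l : Spinor} (hf : DifferentiableAt ℝ f l)
    (hg : DifferentiableAt ℝ g l) (v : Spinor) :
    wirtinger s (fun l' => f l' + g l') l v = wirtinger s f l v + wirtinger s g l v := by
  simp only [wirtinger, fderiv_fun_add hf hg, _root_.add_apply]; ring

theorem wirtinger_sub {s : ℂ} {f g : Spinor → ℂ} {l : Spinor} (hf : DifferentiableAt ℝ f l)
    (hg : DifferentiableAt ℝ g l) (v : Spinor) :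
    wirtinger s (fun l' => f l' - g l') l v = wirtinger s f l v - wirtinger s g l v := by
  simp only [wirtinger, fderiv_fun_sub hf hg, _root_.sub_apply]; ring

theorem wirtinger_mul {s : ℂ} {f g : Spinor → ℂ} {l : Spinor} (hf : DifferentiableAt ℝ f l)
    (hg : DifferentiableAt ℝ g l) (v : Spinor) :
    wirtinger s (fun l' => f l' * g l') l v
      = wirtinger s f l v * g l + f l * wirtinger s g l v := by
  simp only [wirtinger, fderiv_fun_mul hf hg, _root_.add_apply,
    _root_.smul_apply, smul_eq_mul]; ring

theorem wirtinger_square {s : ℂ} {a b : Spinor → Spinor} {l : Spinor}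
    (ha : ∀ α, DifferentiableAt ℝ (fun l' => a l' α) l)
    (hb : ∀ α, DifferentiableAt ℝ (fun l' => b l' α) l) (v : Spinor) :
    wirtinger s (fun l' => square (a l') (b l')) l v
      = square (fun α => wirtinger s (fun l' => a l' α) l v) (b l)
        + square (a l) (fun α => wirtinger s (fun l' => b l' α) l v) := by
  simp only [square_eq]
  have h := wirtinger_sub (s := s) ((ha 1).fun_mul (hb 0)) ((ha 0).fun_mul (hb 1)) v
  rw [h, wirtinger_mul (ha 1) (hb 0), wirtinger_mul (ha 0) (hb 1)]
  ring

theorem dbar_of_differentiableAt {f : Spinor → ℂ} {l : Spinor} (hf : DifferentiableAt ℂ f l)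
    (v : Spinor) : dbar f l v = 0 := by
  simp only [dbar, hf.fderiv_restrictScalars ℝ, ContinuousLinearMap.coe_restrictScalars', map_smul,
    smul_eq_mul]
  linear_combination (fderiv ℂ f l v / 2) * I_mul_I

theorem del_of_differentiableAt {f : Spinor → ℂ} {l : Spinor} (hf : DifferentiableAt ℂ f l)
    (v : Spinor) : del f l v = fderiv ℂ f l v := by
  simp only [del, hf.fderiv_restrictScalars ℝ, ContinuousLinearMap.coe_restrictScalars', map_smul,
    smul_eq_mul]
  linear_combination (-fderiv ℂ f l v / 2) * I_mul_I

/-- The Cauchy-Riemann criterion in any complex normed space. -/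
theorem differentiableAt_complex_of_real {E : Type*} [NormedAddCommGroup E] [NormedSpace ℂ E]
    {f : E → ℂ} {x : E} (hf : DifferentiableAt ℝ f x)
    (h : ∀ u, fderiv ℝ f x (I • u) = I * fderiv ℝ f x u) : DifferentiableAt ℂ f x := by
  rw [differentiableAt_iff_restrictScalars ℝ hf]
  refine ⟨⟨⟨⟨fderiv ℝ f x, map_add _⟩, fun c u => ?_⟩, (fderiv ℝ f x).continuous⟩, rfl⟩
  have hc : c • u = c.re • u + c.im • (I • u) := by
    conv_lhs => rw [← re_add_im c, add_smul, mul_smul]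
    simp only [Complex.coe_smul]
  simp only [hc, map_add, map_smul, h, RingHom.id_apply, real_smul, smul_eq_mul]
  conv_rhs => rw [← re_add_im c]
  ring

theorem differentiableAt_of_dbar_eq_zero {f : Spinor → ℂ} {l : Spinor}
    (hf : DifferentiableAt ℝ f l) (h : ∀ v, dbar f l v = 0) : DifferentiableAt ℂ f l := by
  refine differentiableAt_complex_of_real hf fun u => ?_
  have := h u
  simp only [dbar] at this
  linear_combination (-2 * I) * this + (fderiv ℝ f l (I • u)) * I_mul_I

/-! ### Families of functions of `λ` depending holomorphically on the space-time point -/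

/-- A family, parametrised holomorphically by `x ∈ U`, of functions of `λ ≠ 0`, jointly smooth in
the real sense. -/
structure IsHoloFamily (U : Set Point) (f : Point → Spinor → ℂ) : Prop where
  smooth : ContDiffOn ℝ ∞ (fun p : Point × Spinor => f p.1 p.2) (U ×ˢ {0}ᶜ)
  holo : ∀ x ∈ U, ∀ l : Spinor, l ≠ 0 → DifferentiableAt ℂ (fun y => f y l) x

/-- The derivative of a family along the space-time vector `u`. -/
def dx (f : Point → Spinor → ℂ) (u : Point) (x : Point) (l : Spinor) : ℂ :=
  fderiv ℂ (fun y => f y l) x u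

namespace IsHoloFamily

variable {U : Set Point} {f : Point → Spinor → ℂ} {x : Point} {l : Spinor}

theorem mem_nhds (hU : IsOpen U) (hx : x ∈ U) (hl : l ≠ 0) :
    U ×ˢ {0}ᶜ ∈ 𝓝 ((x, l) : Point × Spinor) :=
  prod_mem_nhds (hU.mem_nhds hx) (isOpen_compl_singleton.mem_nhds hl)

theorem contDiffAt (hf : IsHoloFamily U f) (hU : IsOpen U) (hx : x ∈ U) (hl : l ≠ 0) :
    ContDiffAt ℝ ∞ (fun p : Point × Spinor => f p.1 p.2) (x, l) :=
  hf.smooth.contDiffAt (mem_nhds hU hx hl)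

theorem differentiableAt_snd (hf : IsHoloFamily U f) (hU : IsOpen U) (hx : x ∈ U) (hl : l ≠ 0) :
    DifferentiableAt ℝ (f x) l :=
  ((hf.contDiffAt hU hx hl).differentiableAt (by simp)).comp (f := fun l' : Spinor => (x, l')) l
    (by fun_prop)

theorem fderiv_uncurry (hf : IsHoloFamily U f) (hU : IsOpen U) (hx : x ∈ U) (hl : l ≠ 0)
    (u : Point) (v : Spinor) :
    fderiv ℝ (fun p : Point × Spinor => f p.1 p.2) (x, l) (u, v)
      = dx f u x l + fderiv ℝ (f x) l v := by
  have hd := ((hf.contDiffAt hU hx hl).differentiableAt (by simp)).hasFDerivAt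
  have h1 := (hd.comp (f := fun y : Point => (y, l)) x
    ((hasFDerivAt_id x).prodMk (hasFDerivAt_const l x))).fderiv
  have h2 := (hd.comp (f := fun l' : Spinor => (x, l')) l
    ((hasFDerivAt_const x l).prodMk (hasFDerivAt_id l))).fderiv
  have h3 := (hf.holo x hx l hl).fderiv_restrictScalars ℝ
  have e1 : dx f u x l = fderiv ℝ (fun p : Point × Spinor => f p.1 p.2) (x, l) (u, 0) := by
    have : dx f u x l = (fderiv ℂ (fun y => f y l) x).restrictScalars ℝ u := rfl
    rw [this, ← h3]
    exact congrArg (fun L => L u) h1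
  have e2 : fderiv ℝ (f x) l v = fderiv ℝ (fun p : Point × Spinor => f p.1 p.2) (x, l) (0, v) :=
    congrArg (fun L => L v) h2
  rw [e1, e2, ← map_add]
  simp

/-- Derivatives along `x` commute with those along any direction `a` of `(x, λ)`, and the latter are
again holomorphic in `x`. -/
theorem fderiv_uncurry_holo (hf : IsHoloFamily U f) (hU : IsOpen U) (hx : x ∈ U) (hl : l ≠ 0)
    (a : Point × Spinor) :
    DifferentiableAt ℂ
      (fun y => fderiv ℝ (fun p : Point × Spinor => f p.1 p.2) (y, l) a) x ∧
    ∀ u, fderiv ℂ (fun y => fderiv ℝ (fun p : Point × Spinor => f p.1 p.2) (y, l) a) x u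
      = fderiv ℝ (fun p : Point × Spinor => dx f u p.1 p.2) (x, l) a := by
  set Φ : Point × Spinor → ℂ := fun p => f p.1 p.2 with hΦ
  have hc := hf.contDiffAt hU hx hl
  have hD : HasFDerivAt (fderiv ℝ Φ) (fderiv ℝ (fderiv ℝ Φ) (x, l)) (x, l) :=
    ((hc.fderiv_right (m := 1) (WithTop.coe_le_coe.2 le_top)).differentiableAt
      (by simp)).hasFDerivAt
  have hsymm : IsSymmSndFDerivAt ℝ Φ (x, l) :=
    hc.isSymmSndFDerivAt (by
      rw [minSmoothness_of_isRCLikeNormedField]; exact WithTop.coe_le_coe.2 le_top)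
  have hy : HasFDerivAt (fun y : Point => fderiv ℝ Φ (y, l))
      ((fderiv ℝ (fderiv ℝ Φ) (x, l)).comp (.inl ℝ Point Spinor)) x :=
    hD.comp (f := fun y : Point => (y, l)) x ((hasFDerivAt_id x).prodMk (hasFDerivAt_const l x))
  have hya := hy.clm_apply (hasFDerivAt_const a x)
  have hdu : ∀ u, HasFDerivAt (fun p : Point × Spinor => dx f u p.1 p.2) _ (x, l) := fun u =>
    (hD.clm_apply (hasFDerivAt_const ((u, 0) : Point × Spinor) (x, l))).congr_of_eventuallyEq <| by
      filter_upwards [mem_nhds hU hx hl] with p hp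
      rw [hf.fderiv_uncurry hU hp.1 hp.2]
      simp
  have key : ∀ u, fderiv ℝ (fun y => fderiv ℝ Φ (y, l) a) x u
      = fderiv ℝ (fun p : Point × Spinor => dx f u p.1 p.2) (x, l) a := by
    intro u
    rw [(hdu u).fderiv, hya.fderiv]
    simpa using hsymm (u, 0) a
  have hdiff : DifferentiableAt ℂ (fun y => fderiv ℝ Φ (y, l) a) x := by
    refine differentiableAt_complex_of_real hya.differentiableAt fun u => ?_
    rw [key, key]
    have : (fun p : Point × Spinor => dx f (I • u) p.1 p.2)
        = fun p => I * dx f u p.1 p.2 := by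
      funext p; simp [dx]
    rw [this, fderiv_const_mul (hdu u).differentiableAt]
    rfl
  refine ⟨hdiff, fun u => ?_⟩
  rw [← key u, hdiff.fderiv_restrictScalars ℝ]
  rfl

theorem dx (hf : IsHoloFamily U f) (hU : IsOpen U) (u : Point) :
    IsHoloFamily U (TwistorSigma.dx f u) where
  smooth := by
    have ho : IsOpen (U ×ˢ ({0}ᶜ : Set Spinor)) := hU.prod isOpen_compl_singleton
    have h := (hf.smooth.fderiv_of_isOpen (m := ∞) ho (by simp)).clm_apply
      (contDiffOn_const (c := ((u, 0) : Point × Spinor)))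
    refine h.congr fun p hp => ?_
    rw [hf.fderiv_uncurry hU hp.1 hp.2]
    simp
  holo x hx l hl := by
    refine (hf.fderiv_uncurry_holo hU hx hl (u, 0)).1.congr_of_eventuallyEq ?_
    filter_upwards [hU.mem_nhds hx] with y hy
    rw [hf.fderiv_uncurry hU hy hl]
    simp

theorem dx_comm (hf : IsHoloFamily U f) (hU : IsOpen U) (hx : x ∈ U) (hl : l ≠ 0) (u v : Point) :
    TwistorSigma.dx (TwistorSigma.dx f u) v x l = TwistorSigma.dx (TwistorSigma.dx f v) u x l := by
  have h := (hf.fderiv_uncurry_holo hU hx hl (v, 0)).2 u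
  rw [(hf.dx hU u).fderiv_uncurry hU hx hl, map_zero, add_zero] at h
  rw [← h]
  unfold TwistorSigma.dx
  refine congrArg (fun L : Point →L[ℂ] ℂ => L u) (EventuallyEq.fderiv_eq ?_)
  filter_upwards [hU.mem_nhds hx] with y hy
  rw [hf.fderiv_uncurry hU hy hl, map_zero, add_zero]
  rfl

theorem fderiv_snd_holo (hf : IsHoloFamily U f) (hU : IsOpen U) (hx : x ∈ U) (hl : l ≠ 0)
    (v : Spinor) :
    DifferentiableAt ℂ (fun y => fderiv ℝ (f y) l v) x ∧
    ∀ u, fderiv ℂ (fun y => fderiv ℝ (f y) l v) x u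
      = fderiv ℝ (TwistorSigma.dx f u x) l v := by
  have e : (fun y => fderiv ℝ (f y) l v) =ᶠ[𝓝 x]
      fun y => fderiv ℝ (fun p : Point × Spinor => f p.1 p.2) (y, l) (0, v) := by
    filter_upwards [hU.mem_nhds hx] with y hy
    rw [hf.fderiv_uncurry hU hy hl]
    simp [TwistorSigma.dx]
  have h := hf.fderiv_uncurry_holo hU hx hl (0, v)
  refine ⟨h.1.congr_of_eventuallyEq e, fun u => ?_⟩
  rw [e.fderiv_eq, h.2, (hf.dx hU u).fderiv_uncurry hU hx hl]
  simp [TwistorSigma.dx]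

theorem wirtinger_holo (hf : IsHoloFamily U f) (hU : IsOpen U) (hx : x ∈ U) (hl : l ≠ 0)
    (s : ℂ) (v : Spinor) : DifferentiableAt ℂ (fun y => wirtinger s (f y) l v) x := by
  have h1 := (hf.fderiv_snd_holo hU hx hl v).1
  have h2 := (hf.fderiv_snd_holo hU hx hl (I • v)).1
  unfold wirtinger
  fun_prop

/-- Wirtinger derivatives in `λ` commute with derivatives in `x`. -/
theorem fderiv_wirtinger (hf : IsHoloFamily U f) (hU : IsOpen U) (hx : x ∈ U) (hl : l ≠ 0)
    (s : ℂ) (v : Spinor) (u : Point) :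
    fderiv ℂ (fun y => wirtinger s (f y) l v) x u = wirtinger s (TwistorSigma.dx f u x) l v := by
  have h1 := hf.fderiv_snd_holo hU hx hl v
  have h2 := hf.fderiv_snd_holo hU hx hl (I • v)
  have h := (((h1.1.hasFDerivAt.add (h2.1.hasFDerivAt.const_mul s)).mul_const (2⁻¹ : ℂ)).fderiv)
  simp only [wirtinger, div_eq_mul_inv]
  have h' := congrArg (fun L => L u) h
  simp only [_root_.smul_apply, _root_.add_apply, smul_eq_mul, h1.2,
    h2.2] at h'
  rw [mul_comm, ← h']
  rfl

end IsHoloFamily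

/-! ### The Cauchy-Pompeiu formula on the plane -/

theorem integrableOn_one_add_sq_inv (C : ℝ) :
    IntegrableOn (fun r : ℝ => C / (1 + |r|) ^ 2) (Ioi 0) := by
  have h := (integrable_one_add_norm (E := ℝ) (μ := volume) (r := 2) (by simp)).const_mul C
  refine (h.congr (ae_of_all _ fun r => ?_)).integrableOn
  have : (0 : ℝ) ≤ 1 + |r| := by positivity
  simp [Real.rpow_neg this, div_eq_mul_inv]

/-- In the plane, `(|w| (1 + |w|)²)⁻¹` is integrable: the pole is mild and the decay is cubic. -/
theorem integrable_norm_mul_one_add_sq_inv (C : ℝ) :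
    Integrable (fun w : ℂ => C / (‖w‖ * (1 + ‖w‖) ^ 2)) := by
  rw [integrable_fun_norm_addHaar volume (f := fun r : ℝ => C / (r * (1 + r) ^ 2))]
  refine (integrableOn_one_add_sq_inv C).congr_fun (fun r hr => ?_) measurableSet_Ioi
  have hr : (0 : ℝ) < r := hr
  simp only [finrank_real_complex, abs_of_pos hr, smul_eq_mul]
  field_simp
  simp

theorem integrable_polar {A : ℝ × ℝ → ℂ} {C : ℝ} (hA : Continuous A)
    (hb : ∀ p, ‖A p‖ ≤ C / (1 + |p.1|) ^ 2) :
    Integrable A ((volume.restrict (Ioi 0)).prod (volume.restrict (Ioo (-Real.pi) Real.pi))) := by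
  have h := (integrableOn_one_add_sq_inv C).mul_prod
    (integrable_const (μ := volume.restrict (Ioo (-Real.pi) Real.pi)) (1 : ℝ))
  refine h.mono' hA.aestronglyMeasurable (ae_of_all _ fun p => ?_)
  simpa using hb p

/-- The **Cauchy-Pompeiu formula** on the whole plane, for a function with a limit at infinity:
`∫ w⁻¹ ∂q/∂w̄ = π (q(∞) - q(0))`. In polar coordinates `2 w⁻¹ ∂q/∂w̄ r dr dθ` is
`(∂_r q + i r⁻¹ ∂_θ q) dr dθ`, whose angular part integrates to zero on circles and whose radial
part gives the boundary values. -/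
theorem integral_dbar_div (q : ℂ → ℂ) {qi : ℂ} {C : ℝ} (hq : Differentiable ℝ q)
    (hc : Continuous (fderiv ℝ q))
    (hC : ∀ w c, ‖fderiv ℝ q w c‖ ≤ C * ‖c‖ / (1 + ‖w‖) ^ 2)
    (hlim : Tendsto q (Bornology.cobounded ℂ) (𝓝 qi)) :
    ∫ w, ((fderiv ℝ q w 1 + I * fderiv ℝ q w I) / 2) / w = Real.pi * (qi - q 0) := by
  set e : ℝ → ℂ := fun θ => exp (θ * I) with he
  have hen : ∀ θ, ‖e θ‖ = 1 := fun θ => norm_exp_ofReal_mul_I θ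
  have hec : Continuous e := by fun_prop
  set A : ℝ × ℝ → ℂ := fun p => fderiv ℝ q (p.1 * e p.2) (e p.2) with hA
  set B : ℝ × ℝ → ℂ := fun p => fderiv ℝ q (p.1 * e p.2) (I * e p.2) with hB
  have hAc : Continuous A := by
    refine (hc.comp ?_).clm_apply ?_ <;> fun_prop
  have hBc : Continuous B := by
    refine (hc.comp ?_).clm_apply ?_ <;> fun_prop
  have hAb : ∀ p, ‖A p‖ ≤ C / (1 + |p.1|) ^ 2 := fun p => by
    simpa [hen] using hC (p.1 * e p.2) (e p.2)
  have hBb : ∀ p, ‖B p‖ ≤ C / (1 + |p.1|) ^ 2 := fun p => by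
    simpa [hen] using hC (p.1 * e p.2) (I * e p.2)
  have hAi := integrable_polar hAc hAb
  have hBi := integrable_polar hBc hBb
  rw [← Complex.integral_comp_polarCoord_symm, polarCoord_target]
  have h1 : ∀ p ∈ Ioi (0 : ℝ) ×ˢ Ioo (-Real.pi) Real.pi,
      p.1 • (((fderiv ℝ q (Complex.polarCoord.symm p) 1
        + I * fderiv ℝ q (Complex.polarCoord.symm p) I) / 2) / Complex.polarCoord.symm p)
      = (A p + I * B p) / 2 := by
    intro p hp
    have hp1 : (p.1 : ℂ) ≠ 0 := ofReal_ne_zero.2 (ne_of_gt hp.1)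
    have hs : Complex.polarCoord.symm p = p.1 * e p.2 := by
      simp [he, exp_mul_I]
    have hcs : e p.2 = Real.cos p.2 • (1 : ℂ) + Real.sin p.2 • I := by
      simp [he, exp_mul_I]
    have hcs' : I * e p.2 = (-Real.sin p.2) • (1 : ℂ) + Real.cos p.2 • I := by
      rw [hcs]; simp only [real_smul, ofReal_neg]
      linear_combination (Real.sin p.2 : ℂ) * I_mul_I
    have hne : e p.2 ≠ 0 := exp_ne_zero _
    -- `e⁻¹ ∂_w̄ = ½ (∂_e + i ∂_{ie})` for the unit vector `e`
    have hinv : (Real.cos p.2 - Real.sin p.2 * I) * e p.2 = 1 := by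
      rw [hcs]; simp only [real_smul]
      have : (Real.cos p.2 : ℂ) ^ 2 + (Real.sin p.2 : ℂ) ^ 2 = 1 := by
        exact_mod_cast Real.cos_sq_add_sin_sq p.2
      linear_combination this - (Real.sin p.2 : ℂ) ^ 2 * I_mul_I
    have hAv : A p = Real.cos p.2 * fderiv ℝ q (p.1 * e p.2) 1
        + Real.sin p.2 * fderiv ℝ q (p.1 * e p.2) I := by
      simp only [hA]; conv_lhs => rw [show ∀ L : ℂ →L[ℝ] ℂ, L (e p.2) = _ from
        fun L => by rw [hcs, map_add, map_smul, map_smul]]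
      simp
    have hBv : B p = -Real.sin p.2 * fderiv ℝ q (p.1 * e p.2) 1
        + Real.cos p.2 * fderiv ℝ q (p.1 * e p.2) I := by
      simp only [hB]; conv_lhs => rw [show ∀ L : ℂ →L[ℝ] ℂ, L (I * e p.2) = _ from
        fun L => by rw [hcs', map_add, map_smul, map_smul]]
      simp
    rw [hs, hAv, hBv, real_smul]
    generalize fderiv ℝ q (p.1 * e p.2) 1 = a
    generalize fderiv ℝ q (p.1 * e p.2) I = b
    have hi : (e p.2)⁻¹ = Real.cos p.2 - Real.sin p.2 * I := (eq_inv_of_mul_eq_one_left hinv).symm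
    rw [div_eq_mul_inv _ ((p.1 : ℂ) * e p.2), mul_inv, hi]
    field_simp
    linear_combination (- b * Real.sin p.2) * I_mul_I
  rw [setIntegral_congr_fun (measurableSet_Ioi.prod measurableSet_Ioo) h1,
    Measure.volume_eq_prod, ← Measure.prod_restrict, integral_div,
    integral_add hAi (hBi.const_mul I), integral_const_mul]
  have hAint : ∫ p, A p ∂((volume.restrict (Ioi 0)).prod
      (volume.restrict (Ioo (-Real.pi) Real.pi))) = 2 * Real.pi * (qi - q 0) := by
    rw [integral_prod_symm _ hAi]
    have hin : ∀ θ : ℝ, ∫ r in Ioi (0 : ℝ), A (r, θ) = qi - q 0 := by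
      intro θ
      have hd : ∀ r : ℝ, HasDerivAt (fun r : ℝ => q (r * e θ)) (A (r, θ)) r := by
        intro r
        have h2 : HasDerivAt (fun r : ℝ => (r : ℂ) * e θ) (e θ) r := by
          simpa using (ofRealCLM.hasDerivAt (x := r)).mul_const (e θ)
        exact (hq (r * e θ)).hasFDerivAt.comp_hasDerivAt r h2
      have ht : Tendsto (fun r : ℝ => q (r * e θ)) atTop (𝓝 qi) := by
        refine hlim.comp ?_
        rw [← tendsto_norm_atTop_iff_cobounded]
        refine tendsto_abs_atTop_atTop.congr fun r => ?_
        simp [hen]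
      have hi : IntegrableOn (fun r => A (r, θ)) (Ioi 0) := by
        refine (integrableOn_one_add_sq_inv C).mono' ?_ (ae_of_all _ fun r => hAb (r, θ))
        exact (hAc.comp (by fun_prop : Continuous fun r : ℝ => (r, θ))).aestronglyMeasurable
      have := integral_Ioi_of_hasDerivAt_of_tendsto (hd 0).continuousAt.continuousWithinAt
        (fun r _ => hd r) hi ht
      simpa using this
    simp only [hin, integral_const, measureReal_restrict_apply_univ, Real.volume_real_Ioo,
      real_smul]
    rw [max_eq_left (by linarith [Real.pi_pos])]
    push_cast; ring
  have hBint : ∫ p, B p ∂((volume.restrict (Ioi 0)).prod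
      (volume.restrict (Ioo (-Real.pi) Real.pi))) = 0 := by
    rw [integral_prod _ hBi]
    have hin : ∀ r ∈ Ioi (0 : ℝ), ∫ θ in Ioo (-Real.pi) Real.pi, B (r, θ) = 0 := by
      intro r hr
      have hr' : (r : ℂ) ≠ 0 := ofReal_ne_zero.2 (ne_of_gt hr)
      have hd : ∀ θ : ℝ, HasDerivAt (fun θ : ℝ => q (r * e θ)) (r * B (r, θ)) θ := by
        intro θ
        have h2 : HasDerivAt (fun θ : ℝ => (r : ℂ) * e θ) (r • (I * e θ)) θ := by
          have h3 : HasDerivAt (fun θ : ℝ => (θ : ℂ) * I) I θ := by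
            simpa using (ofRealCLM.hasDerivAt (x := θ)).mul_const I
          have := (h3.cexp).const_mul (r : ℂ)
          rw [real_smul, mul_comm I]
          exact this
        have := (hq (r * e θ)).hasFDerivAt.comp_hasDerivAt θ h2
        rw [map_smul, real_smul] at this
        exact this
      have hint : IntervalIntegrable (fun θ => (r : ℂ) * B (r, θ)) volume (-Real.pi) Real.pi := by
        apply Continuous.intervalIntegrable
        exact continuous_const.mul (hBc.comp (by fun_prop))
      have h4 := intervalIntegral.integral_eq_sub_of_hasDerivAt (fun θ _ => hd θ) hint
      have h5 : e Real.pi = e (-Real.pi) := by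
        simp only [he, exp_pi_mul_I]; push_cast; rw [neg_mul, exp_neg, exp_pi_mul_I]; norm_num
      rw [h5, sub_self, intervalIntegral.integral_const_mul,
        intervalIntegral.integral_of_le (by linarith [Real.pi_pos]),
        integral_Ioc_eq_integral_Ioo] at h4
      exact (mul_eq_zero.1 h4).resolve_left hr'
    rw [setIntegral_congr_fun measurableSet_Ioi hin]
    simp
  rw [hAint, hBint]
  ring

/-! ### Functions of weight zero on the projective line -/

/-- A function on `ℙ¹`, smooth in the real sense, as a function of weight zero of `λ ≠ 0`. -/
structure IsWeightZero (g : Spinor → ℂ) : Prop where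
  smooth : ContDiffOn ℝ 1 g {0}ᶜ
  weight : ∀ l : Spinor, l ≠ 0 → ∀ b : ℂ, b ≠ 0 → g (b • l) = g l

namespace IsWeightZero

variable {g : Spinor → ℂ} {l : Spinor}

theorem contDiffAt (hg : IsWeightZero g) (hl : l ≠ 0) : ContDiffAt ℝ 1 g l :=
  hg.smooth.contDiffAt (isOpen_compl_singleton.mem_nhds hl)

theorem differentiableAt (hg : IsWeightZero g) (hl : l ≠ 0) : DifferentiableAt ℝ g l :=
  (hg.contDiffAt hl).differentiableAt (by simp)

/-- Euler's identity. -/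
theorem fderiv_smul_self (hg : IsWeightZero g) (hl : l ≠ 0) (c : ℂ) :
    fderiv ℝ g l (c • l) = 0 := by
  have h1 : HasDerivAt (fun t : ℝ => l + t • (c • l)) (c • l) 0 := by
    simpa using ((hasDerivAt_id (0 : ℝ)).smul_const (c • l)).const_add l
  have h2 : HasDerivAt (fun t : ℝ => g (l + t • (c • l))) (fderiv ℝ g l (c • l)) 0 := by
    refine HasFDerivAt.comp_hasDerivAt (0 : ℝ) (l := g) ?_ h1
    simpa using (hg.differentiableAt hl).hasFDerivAt
  have h3 : (fun t : ℝ => g (l + t • (c • l))) =ᶠ[𝓝 0] fun _ => g l := by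
    have hc : ContinuousAt (fun t : ℝ => 1 + (t : ℂ) * c) 0 := by fun_prop
    filter_upwards [hc.eventually_ne (y := 0) (by simp)] with t ht
    rw [← hg.weight l hl _ ht, add_smul, one_smul, mul_smul, Complex.coe_smul]
  exact h2.unique ((hasDerivAt_const (0 : ℝ) (g l)).congr_of_eventuallyEq h3)

theorem fderiv_smul_smul (hg : IsWeightZero g) (hl : l ≠ 0) {b : ℝ} (hb : b ≠ 0) (v : Spinor) :
    fderiv ℝ g (b • l) (b • v) = fderiv ℝ g l v := by
  have h1 : HasFDerivAt (fun l' : Spinor => b • l') (b • ContinuousLinearMap.id ℝ Spinor) l :=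
    (hasFDerivAt_id l).const_smul b
  have h2 := (hg.differentiableAt (smul_ne_zero hb hl)).hasFDerivAt.comp l h1
  have h3 : (g ∘ fun l' : Spinor => b • l') =ᶠ[𝓝 l] g := by
    filter_upwards [isOpen_compl_singleton.mem_nhds hl] with l' hl'
    have := hg.weight l' hl' b (ofReal_ne_zero.2 hb)
    rwa [Complex.coe_smul] at this
  rw [← h3.fderiv_eq, h2.fderiv]
  simp

theorem hasFDerivAt_affine (hg : IsWeightZero g) {κ₁ κ₂ : Spinor} (hκ : angle κ₁ κ₂ = 1) (w : ℂ) :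
    HasFDerivAt (fun w : ℂ => g (κ₁ + w • κ₂))
      ((fderiv ℝ g (κ₁ + w • κ₂)).comp ((ContinuousLinearMap.id ℝ ℂ).smulRight κ₂)) w := by
  refine (hg.differentiableAt (add_smul_ne_zero hκ w)).hasFDerivAt.comp
    (f := fun w : ℂ => κ₁ + w • κ₂) w ?_
  exact ((ContinuousLinearMap.id ℝ ℂ).smulRight κ₂).hasFDerivAt.const_add κ₁

end IsWeightZero

/-- For functions of weight zero the derivative in the affine coordinate `w` decays as `|w|⁻²`,
uniformly for compact sets of parameters: away from `w = ∞` this is homogeneity, and near `w = ∞`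
Euler's identity trades the vector `κ₂` for `-w⁻¹ κ₁`. -/
theorem exists_bound_fderiv_affine {E : Type*} [TopologicalSpace E] {S : Set E} (hS : IsCompact S)
    {g : E → Spinor → ℂ} (hg : ∀ e ∈ S, IsWeightZero (g e))
    (hc : ContinuousOn (fun p : E × Spinor => fderiv ℝ (g p.1) p.2) (S ×ˢ {0}ᶜ))
    {κ₁ κ₂ : Spinor} (hκ : angle κ₁ κ₂ = 1) :
    ∃ C : ℝ, ∀ e ∈ S, ∀ w c : ℂ,
      ‖fderiv ℝ (g e) (κ₁ + w • κ₂) (c • κ₂)‖ ≤ C * ‖c‖ / (1 + ‖w‖) ^ 2 := by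
  have hK : IsCompact (S ×ˢ Metric.sphere (0 : Spinor) 1) := hS.prod (isCompact_sphere 0 1)
  obtain ⟨C₀, hC₀⟩ := hK.exists_bound_of_continuousOn (hc.mono (prod_mono_right fun l hl h => by
    rw [mem_singleton_iff.1 h] at hl; simp at hl))
  have hpos : 0 ≤ max C₀ 0 := le_max_right _ _
  set C := max C₀ 0 with hCdef
  have hC : ∀ e ∈ S, ∀ l : Spinor, l ≠ 0 → ∀ v, ‖fderiv ℝ (g e) l v‖ * ‖l‖ ≤ C * ‖v‖ := by
    intro e he l hl v
    have hn : 0 < ‖l‖ := norm_pos_iff.2 hl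
    rw [← (hg e he).fderiv_smul_smul hl (inv_ne_zero hn.ne') v]
    have h1 : ‖fderiv ℝ (g e) (‖l‖⁻¹ • l)‖ ≤ C :=
      (hC₀ (e, ‖l‖⁻¹ • l) ⟨he, by simp [norm_smul, hn.ne']⟩).trans (le_max_left _ _)
    have h2 := (fderiv ℝ (g e) (‖l‖⁻¹ • l)).le_of_opNorm_le h1 (‖l‖⁻¹ • v)
    rw [norm_smul, norm_inv, norm_norm] at h2
    calc _ ≤ C * (‖l‖⁻¹ * ‖v‖) * ‖l‖ := by gcongr
      _ = C * ‖v‖ := by field_simp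
  have hangle : ∀ a b : Spinor, ‖angle a b‖ ≤ 2 * ‖a‖ * ‖b‖ := by
    intro a b
    unfold angle
    calc _ ≤ ‖a 1‖ * ‖b 0‖ + ‖a 0‖ * ‖b 1‖ := by
          simpa using norm_sub_le (a 1 * b 0) (a 0 * b 1)
      _ ≤ ‖a‖ * ‖b‖ + ‖a‖ * ‖b‖ := by gcongr <;> exact norm_le_pi_norm _ _
      _ = _ := by ring
  set N := ‖κ₁‖ + ‖κ₂‖ with hN
  refine ⟨2 * C * N ^ 2, fun e he w c => ?_⟩
  have hl := add_smul_ne_zero hκ w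
  set l := κ₁ + w • κ₂ with hldef
  -- Euler's identity turns the vector `w c κ₂` into `-c κ₁`
  have hE : ‖fderiv ℝ (g e) l (c • κ₂)‖ * ‖w‖ * ‖l‖ ≤ C * (‖c‖ * ‖κ₁‖) := by
    rcases eq_or_ne w 0 with rfl | hw
    · simp; positivity
    have h := hC e he l hl ((‖w‖ / w * c) • κ₁)
    have h3 := (hg e he).fderiv_smul_self hl (‖w‖ / w * c)
    rw [show (‖w‖ / w * c) • l = (‖w‖ / w * c) • κ₁ + ‖w‖ • (c • κ₂) by
      rw [hldef, smul_add, smul_smul, ← Complex.coe_smul, smul_smul]; congr 2; field_simp,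
      map_add, map_smul _ ‖w‖ (c • κ₂)] at h3
    rw [eq_neg_of_add_eq_zero_left h3, norm_neg, norm_smul, norm_norm, norm_smul, norm_mul,
      norm_div, norm_real, norm_norm, div_self (norm_ne_zero_iff.2 hw), one_mul] at h
    rwa [mul_comm ‖fderiv ℝ (g e) l (c • κ₂)‖ ‖w‖]
  have h0 := hC e he l hl (c • κ₂)
  rw [norm_smul] at h0
  have hlow : 1 + ‖w‖ ≤ 2 * N * ‖l‖ := by
    have h1 : ‖(1 : ℂ)‖ ≤ 2 * ‖l‖ * ‖κ₂‖ := by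
      have := lam1_affine hκ 1 w
      rw [one_smul] at this
      rw [← this]; exact hangle _ _
    have h2 : ‖w‖ ≤ 2 * ‖κ₁‖ * ‖l‖ := by
      have := lam2_affine hκ 1 w
      rw [one_smul] at this
      conv_lhs => rw [← this]
      exact hangle _ _
    rw [norm_one] at h1
    calc 1 + ‖w‖ ≤ 2 * ‖l‖ * ‖κ₂‖ + 2 * ‖κ₁‖ * ‖l‖ := add_le_add h1 h2
      _ = _ := by rw [hN]; ring
  rw [le_div_iff₀ (by positivity)]
  calc ‖fderiv ℝ (g e) l (c • κ₂)‖ * (1 + ‖w‖) ^ 2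
      = ‖fderiv ℝ (g e) l (c • κ₂)‖ * (1 + ‖w‖) * (1 + ‖w‖) := by ring
    _ ≤ ‖fderiv ℝ (g e) l (c • κ₂)‖ * (1 + ‖w‖) * (2 * N * ‖l‖) := by gcongr
    _ = 2 * N * (‖fderiv ℝ (g e) l (c • κ₂)‖ * ‖l‖
        + ‖fderiv ℝ (g e) l (c • κ₂)‖ * ‖w‖ * ‖l‖) := by ring
    _ ≤ 2 * N * (C * (‖c‖ * ‖κ₂‖) + C * (‖c‖ * ‖κ₁‖)) := by gcongr
    _ = 2 * C * N ^ 2 * ‖c‖ := by rw [hN]; ring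

/-- Stokes' theorem on `ℙ¹`, with simple poles at `κ₁` and `κ₂`, in the affine coordinate. -/
theorem integral_dbar_affine {g : Spinor → ℂ} (hg : IsWeightZero g) {κ₁ κ₂ : Spinor}
    (hκ : angle κ₁ κ₂ = 1) :
    ∫ w : ℂ, dbar g (κ₁ + w • κ₂) κ₂ / w = Real.pi * (g κ₂ - g κ₁) := by
  have hfd : ∀ w c : ℂ, fderiv ℝ (fun w : ℂ => g (κ₁ + w • κ₂)) w c
      = fderiv ℝ g (κ₁ + w • κ₂) (c • κ₂) := fun w c => by
    rw [(hg.hasFDerivAt_affine hκ w).fderiv]; rfl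
  have hcont : ContinuousOn (fderiv ℝ g) {0}ᶜ :=
    hg.smooth.continuousOn_fderiv_of_isOpen isOpen_compl_singleton (by simp)
  obtain ⟨C, hC⟩ := exists_bound_fderiv_affine (S := univ) (E := Unit) isCompact_univ
    (g := fun _ => g) (fun _ _ => hg)
    (hcont.comp continuousOn_snd fun p hp => hp.2) hκ
  have h := integral_dbar_div (fun w : ℂ => g (κ₁ + w • κ₂)) (qi := g κ₂) (C := C)
    (fun w => (hg.hasFDerivAt_affine hκ w).differentiableAt) ?_
    (fun w c => by rw [hfd]; exact hC () trivial w c) ?_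
  · simp only [hfd, one_smul, zero_smul, add_zero] at h
    exact h
  · have : fderiv ℝ (fun w : ℂ => g (κ₁ + w • κ₂)) = fun w =>
        (fderiv ℝ g (κ₁ + w • κ₂)).comp ((ContinuousLinearMap.id ℝ ℂ).smulRight κ₂) :=
      funext fun w => (hg.hasFDerivAt_affine hκ w).fderiv
    rw [this]
    refine Continuous.clm_comp ?_ continuous_const
    exact hcont.comp_continuous (by fun_prop) fun w => add_smul_ne_zero hκ w
  · have h1 : Tendsto (fun w : ℂ => w⁻¹ • κ₁ + κ₂) (Bornology.cobounded ℂ) (𝓝 κ₂) := by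
      simpa using ((tendsto_inv₀_cobounded (α := ℂ)).smul_const κ₁).add_const κ₂
    refine (((hg.differentiableAt (ne_zero_of_angle_right hκ)).continuousAt.tendsto).comp
      h1).congr' ?_
    filter_upwards [Bornology.eventually_ne_cobounded (0 : ℂ)] with w hw
    have := hg.weight _ (smul_add_ne_zero hκ w⁻¹) w hw
    rw [Function.comp_apply, ← this, smul_add, smul_inv_smul₀ hw]

/-! ### Variations of families of twistor curves -/

/-- The variation `δ_u F^α` of a family of curves along the space-time vector `u`. -/
def variation (F : Point → Spinor → Spinor) (u x : Point) (l : Spinor) : Spinor :=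
  fun α => dx (fun y l' => F y l' α) u x l

/-- Contraction of a linear form in `μ` with its lowered-index components, the convention of
`dMuLow`. -/
theorem apply_eq_square (L : Spinor →L[ℂ] ℂ) (a : Spinor) :
    L a = square (fun α => L (raise (Pi.single α 1))) a := by
  have e0 : raise (Pi.single 0 1) = -Pi.single 1 1 := by ext i; fin_cases i <;> simp [raise]
  have e1 : raise (Pi.single 1 1) = Pi.single 0 1 := by ext i; fin_cases i <;> simp [raise]
  have ha : a = a 0 • Pi.single 0 1 + a 1 • Pi.single 1 1 := by
    ext i; fin_cases i <;> simp
  rw [square_eq, e0, e1, map_neg]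
  conv_lhs => rw [ha, map_add, map_smul, map_smul]
  simp only [smul_eq_mul]; ring

theorem fderiv_eq_square_dMuLow (f : Spinor → ℂ) (μ a : Spinor) :
    fderiv ℂ f μ a = square (dMuLow f μ) a := apply_eq_square _ a

theorem sum_dMuUp_mul (f : Spinor → ℂ) (μ a : Spinor) :
    ∑ α, dMuUp f μ α * a α = square (dMuLow f μ) a := by
  have ha : a = a 0 • Pi.single 0 1 + a 1 • Pi.single 1 1 := by
    ext i; fin_cases i <;> simp
  rw [← fderiv_eq_square_dMuLow]
  conv_rhs => rw [ha, map_add, map_smul, map_smul]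
  simp only [Fin.sum_univ_two, dMuUp, smul_eq_mul]; ring

namespace IsCurveFamily

variable {U : Set Point} {T : Set (Spinor × Spinor)} {h : Spinor → Spinor → ℂ}
  {F : Point → Spinor → Spinor} {x : Point} {l : Spinor}

theorem component (hF : IsCurveFamily U T h F) (α : Fin 2) :
    IsHoloFamily U (fun x l => F x l α) where
  smooth := contDiffOn_pi.1 hF.smooth α
  holo x hx l hl := differentiableAt_pi.1 (hF.holo x hx l hl) α

theorem fderiv_eq_variation (hF : IsCurveFamily U T h F) (hx : x ∈ U) (hl : l ≠ 0) (u : Point) :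
    fderiv ℂ (fun y => F y l) x u = variation F u x l := by
  rw [fderiv_pi fun α => (hF.component α).holo x hx l hl]
  rfl

theorem variation_smul (hF : IsCurveFamily U T h F) (hU : IsOpen U) (hx : x ∈ U) (hl : l ≠ 0)
    {b : ℂ} (hb : b ≠ 0) (u : Point) : variation F u x (b • l) = b • variation F u x l := by
  rw [← hF.fderiv_eq_variation hx hl, ← hF.fderiv_eq_variation hx (smul_ne_zero hb hl)]
  have : (fun y => F y (b • l)) =ᶠ[𝓝 x] fun y => b • F y l := by
    filter_upwards [hU.mem_nhds hx] with y hy using hF.weight y hy l hl b hb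
  rw [this.fderiv_eq, fderiv_fun_const_smul (hF.holo x hx l hl)]
  rfl

theorem variation_eq_fst (hF : IsCurveFamily U T h F) (hU : IsOpen U) (hx : x ∈ U) (hl : l ≠ 0)
    (hz : ∀ x ∈ U, F x l = x.1) (u : Point) : variation F u x l = u.1 := by
  rw [← hF.fderiv_eq_variation hx hl]
  have : (fun y => F y l) =ᶠ[𝓝 x] fun y => y.1 := by
    filter_upwards [hU.mem_nhds hx] with y hy using hz y hy
  rw [this.fderiv_eq, fderiv_fst]
  rfl

theorem variation_eq_snd (hF : IsCurveFamily U T h F) (hU : IsOpen U) (hx : x ∈ U) (hl : l ≠ 0)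
    (hz : ∀ x ∈ U, F x l = x.2) (u : Point) : variation F u x l = u.2 := by
  rw [← hF.fderiv_eq_variation hx hl]
  have : (fun y => F y l) =ᶠ[𝓝 x] fun y => y.2 := by
    filter_upwards [hU.mem_nhds hx] with y hy using hz y hy
  rw [this.fderiv_eq, fderiv_snd]
  rfl

/-- The derivative in `x` of the Hamiltonian along the curves. -/
theorem hasFDerivAt_hamiltonian (hF : IsCurveFamily U T h F)
    (hh : ∀ p ∈ T, DifferentiableAt ℂ (fun μ => h μ p.2) p.1) (hx : x ∈ U) (hl : l ≠ 0) :
    DifferentiableAt ℂ (fun y => h (F y l) l) x ∧ ∀ u, fderiv ℂ (fun y => h (F y l) l) x u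
      = square (dMuLow (fun μ => h μ l) (F x l)) (variation F u x l) := by
  have h1 := ((hh _ (hF.mem x hx l hl)).hasFDerivAt).comp (f := fun y => F y l) x
    (hF.holo x hx l hl).hasFDerivAt
  refine ⟨h1.differentiableAt, fun u => ?_⟩
  rw [← fderiv_eq_square_dMuLow, ← hF.fderiv_eq_variation hx hl]
  exact congrArg (fun L => L u) h1.fderiv

end IsCurveFamily

theorem IsHoloFamily.contDiffOn_dx {U : Set Point} {f : Point → Spinor → ℂ}
    (hf : IsHoloFamily U f) (hU : IsOpen U) :
    ContDiffOn ℝ 1 (fun p : (Point × Point) × Spinor => TwistorSigma.dx f p.1.2 p.1.1 p.2)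
      ((U ×ˢ univ) ×ˢ {0}ᶜ) := by
  have ho : IsOpen (U ×ˢ ({0}ᶜ : Set Spinor)) := hU.prod isOpen_compl_singleton
  have h := (hf.smooth.fderiv_of_isOpen (m := 1) ho (WithTop.coe_le_coe.2 le_top))
  have h1 : ContDiffOn ℝ 1 (fun p : (Point × Point) × Spinor =>
      fderiv ℝ (fun p : Point × Spinor => f p.1 p.2) (p.1.1, p.2)) ((U ×ˢ univ) ×ˢ {0}ᶜ) :=
    h.comp (f := fun p : (Point × Point) × Spinor => (p.1.1, p.2))
      (ContDiff.contDiffOn (by fun_prop)) fun p hp => ⟨hp.1.1, hp.2⟩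
  have h2 : ContDiffOn ℝ 1 (fun p : (Point × Point) × Spinor => ((p.1.2, 0) : Point × Spinor))
      ((U ×ˢ univ) ×ˢ {0}ᶜ) := ContDiff.contDiffOn (by fun_prop)
  refine (h1.clm_apply h2).congr fun p hp => ?_
  rw [hf.fderiv_uncurry hU hp.1.1 hp.2]
  simp

theorem continuousOn_fderiv_snd {E : Type*} [NormedAddCommGroup E] [NormedSpace ℝ E] {O : Set E}
    (hO : IsOpen O) {G : E → Spinor → ℂ}
    (hG : ContDiffOn ℝ 1 (fun p : E × Spinor => G p.1 p.2) (O ×ˢ {0}ᶜ)) :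
    ContinuousOn (fun p : E × Spinor => fderiv ℝ (G p.1) p.2) (O ×ˢ {0}ᶜ) := by
  have ho : IsOpen (O ×ˢ ({0}ᶜ : Set Spinor)) := hO.prod isOpen_compl_singleton
  have h := hG.continuousOn_fderiv_of_isOpen ho le_rfl
  have h' : ContinuousOn (fun p : E × Spinor =>
      (fderiv ℝ (fun p : E × Spinor => G p.1 p.2) p).comp (.inr ℝ E Spinor)) (O ×ˢ {0}ᶜ) :=
    h.clm_comp continuousOn_const
  refine h'.congr fun p hp => ?_
  have hd := ((hG.contDiffAt (ho.mem_nhds hp)).differentiableAt (by simp)).hasFDerivAt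
  exact (hd.comp (f := fun l' : Spinor => (p.1, l')) p.2
    ((hasFDerivAt_const p.1 p.2).prodMk (hasFDerivAt_id p.2))).fderiv

/-! ### Deformations and the on-shell variation of the action -/

/-- The data of a finite deformation: the background curves `Fb` for `hb`, normalised at `κ₁` and
`κ₂`, and the curves `F = Fb + m` for `hb + h`, where `m = λ₁ λ₂ M` with `M` regular. -/
structure IsDeformation (κ₁ κ₂ : Spinor) (U : Set Point) (T : Set (Spinor × Spinor))
    (hb h : Spinor → Spinor → ℂ) (Fb F m M : Point → Spinor → Spinor) : Prop where
  angle_eq : angle κ₁ κ₂ = 1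
  isOpen : IsOpen U
  back : IsHamiltonian T hb
  pert : IsHamiltonian T h
  curve_back : IsCurveFamily U T hb Fb
  back_left : ∀ x ∈ U, Fb x κ₁ = x.1
  back_right : ∀ x ∈ U, Fb x κ₂ = x.2
  curve : IsCurveFamily U T (fun μ l => hb μ l + h μ l) F
  eq_add : ∀ x ∈ U, ∀ l : Spinor, l ≠ 0 → F x l = Fb x l + m x l
  eq_smul : ∀ x ∈ U, ∀ l : Spinor, l ≠ 0 → m x l = (lam1 κ₂ l * lam2 κ₁ l) • M x l
  smooth : ContDiffOn ℝ ∞ (fun p : Point × Spinor => M p.1 p.2) (U ×ˢ {0}ᶜ)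

/-- The function `[M δ_u(F + Fb)]` of weight zero whose `∂̄`, divided by `λ₁ λ₂`, is the variation
of the Lagrangian. The argument `e` is the pair `(x, u)`. -/
def boundaryTerm (Fb F M : Point → Spinor → Spinor) (e : Point × Point) (l : Spinor) : ℂ :=
  square (M e.1 l) (variation F e.2 e.1 l + variation Fb e.2 e.1 l)

namespace IsDeformation

variable {κ₁ κ₂ : Spinor} {U : Set Point} {T : Set (Spinor × Spinor)}
  {hb h : Spinor → Spinor → ℂ} {Fb F m M : Point → Spinor → Spinor} {x : Point} {l : Spinor}

theorem left_ne_zero (d : IsDeformation κ₁ κ₂ U T hb h Fb F m M) : κ₁ ≠ 0 :=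
  ne_zero_of_angle_left d.angle_eq

theorem right_ne_zero (d : IsDeformation κ₁ κ₂ U T hb h Fb F m M) : κ₂ ≠ 0 :=
  ne_zero_of_angle_right d.angle_eq

theorem curve_left (d : IsDeformation κ₁ κ₂ U T hb h Fb F m M) (x : Point) (hx : x ∈ U) :
    F x κ₁ = x.1 := by
  rw [d.eq_add x hx _ d.left_ne_zero, d.eq_smul x hx _ d.left_ne_zero, d.back_left x hx]
  simp [lam2, angle, mul_comm]

theorem curve_right (d : IsDeformation κ₁ κ₂ U T hb h Fb F m M) (x : Point) (hx : x ∈ U) :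
    F x κ₂ = x.2 := by
  rw [d.eq_add x hx _ d.right_ne_zero, d.eq_smul x hx _ d.right_ne_zero, d.back_right x hx]
  simp [lam1, angle, mul_comm]

theorem contDiffOn_snd (d : IsDeformation κ₁ κ₂ U T hb h Fb F m M) (hx : x ∈ U) :
    ContDiffOn ℝ ∞ (M x) {0}ᶜ :=
  d.smooth.comp (f := fun l : Spinor => (x, l)) (ContDiff.contDiffOn (by fun_prop))
    fun _ hl => ⟨hx, hl⟩

theorem continuousAt_snd (d : IsDeformation κ₁ κ₂ U T hb h Fb F m M) (hx : x ∈ U) (hl : l ≠ 0) :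
    ContinuousAt (M x) l :=
  (d.contDiffOn_snd hx).continuousOn.continuousAt (isOpen_compl_singleton.mem_nhds hl)

/-- `M` has weight `-1`. On the lines `λ₁ = 0` and `λ₂ = 0` this holds by continuity. -/
theorem weight (d : IsDeformation κ₁ κ₂ U T hb h Fb F m M) (hx : x ∈ U) (hl : l ≠ 0) {b : ℂ}
    (hb0 : b ≠ 0) : M x (b • l) = b⁻¹ • M x l := by
  have key : ∀ l' : Spinor, l' ≠ 0 → lam1 κ₂ l' ≠ 0 → lam2 κ₁ l' ≠ 0 →
      M x (b • l') = b⁻¹ • M x l' := by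
    intro l' hl' h1 h2
    have hm : m x (b • l') = b • m x l' := by
      have e1 := d.eq_add x hx _ (smul_ne_zero hb0 hl')
      rw [d.curve.weight x hx l' hl' b hb0, d.curve_back.weight x hx l' hl' b hb0,
        d.eq_add x hx l' hl', smul_add] at e1
      exact (add_left_cancel e1).symm
    rw [d.eq_smul x hx _ (smul_ne_zero hb0 hl'), d.eq_smul x hx _ hl', lam1_smul, lam2_smul,
      smul_smul] at hm
    have hne : b * lam1 κ₂ l' * (b * lam2 κ₁ l') ≠ 0 := by positivity
    rw [← inv_smul_smul₀ hne (M x (b • l')), hm, smul_smul]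
    congr 1
    field_simp
  set c : ℂ → Spinor := fun t => l + t • (κ₁ + κ₂) with hc
  have hcc : Tendsto c (𝓝[≠] 0) (𝓝 l) := by
    have : ContinuousAt c 0 := by fun_prop
    have h0 : c 0 = l := by simp [hc]
    exact (h0 ▸ this.tendsto).mono_left nhdsWithin_le_nhds
  have hadd : ∀ a : ℂ, ∀ᶠ t in 𝓝[≠] (0 : ℂ), a + t ≠ 0 := by
    intro a
    rcases eq_or_ne a 0 with rfl | ha
    · filter_upwards [self_mem_nhdsWithin] with t ht
      simpa using ht
    · have hca : ContinuousAt (fun t : ℂ => a + t) 0 := by fun_prop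
      exact (hca.eventually_ne (y := 0) (by simpa using ha)).filter_mono nhdsWithin_le_nhds
  have hcoord : ∀ t, c t = (lam1 κ₂ l + t) • κ₁ + (lam2 κ₁ l + t) • κ₂ := by
    intro t
    simp only [hc]
    conv_lhs => rw [lam_decomp d.angle_eq l]
    module
  have hM1 : Tendsto (fun t => M x (b • c t)) (𝓝[≠] 0) (𝓝 (M x (b • l))) :=
    (d.continuousAt_snd hx (smul_ne_zero hb0 hl)).tendsto.comp (hcc.const_smul b)
  have hM2 : Tendsto (fun t => b⁻¹ • M x (c t)) (𝓝[≠] 0) (𝓝 (b⁻¹ • M x l)) :=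
    ((d.continuousAt_snd hx hl).tendsto.comp hcc).const_smul b⁻¹
  refine tendsto_nhds_unique_of_eventuallyEq hM1 hM2 ?_
  filter_upwards [hadd (lam1 κ₂ l), hadd (lam2 κ₁ l), hcc.eventually_ne hl] with t h1 h2 h3
  refine key _ h3 ?_ ?_
  · rwa [hcoord, lam1_affine d.angle_eq]
  · rwa [hcoord, lam2_affine d.angle_eq]

theorem contDiffOn_boundaryTerm (d : IsDeformation κ₁ κ₂ U T hb h Fb F m M) :
    ContDiffOn ℝ 1 (fun p : (Point × Point) × Spinor => boundaryTerm Fb F M p.1 p.2)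
      ((U ×ˢ univ) ×ˢ {0}ᶜ) := by
  have hMj : ContDiffOn ℝ 1 (fun p : (Point × Point) × Spinor => M p.1.1 p.2)
      ((U ×ˢ univ) ×ˢ {0}ᶜ) :=
    (d.smooth.of_le (WithTop.coe_le_coe.2 le_top)).comp
      (f := fun p : (Point × Point) × Spinor => (p.1.1, p.2))
      (ContDiff.contDiffOn (by fun_prop)) fun p hp => ⟨hp.1.1, hp.2⟩
  have hMα := contDiffOn_pi.1 hMj
  have hv : ∀ α, ContDiffOn ℝ 1 (fun p : (Point × Point) × Spinor =>
      (variation F p.1.2 p.1.1 p.2 + variation Fb p.1.2 p.1.1 p.2) α) ((U ×ˢ univ) ×ˢ {0}ᶜ) :=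
    fun α => ((d.curve.component α).contDiffOn_dx d.isOpen).add
      ((d.curve_back.component α).contDiffOn_dx d.isOpen)
  simp only [boundaryTerm, square_eq]
  exact ((hMα 1).mul (hv 0)).sub ((hMα 0).mul (hv 1))

theorem isWeightZero_boundaryTerm (d : IsDeformation κ₁ κ₂ U T hb h Fb F m M) (hx : x ∈ U)
    (u : Point) : IsWeightZero (boundaryTerm Fb F M (x, u)) where
  smooth := d.contDiffOn_boundaryTerm.comp (f := fun l : Spinor => ((x, u), l))
    (ContDiff.contDiffOn (by fun_prop)) fun _ hl => ⟨⟨hx, trivial⟩, hl⟩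
  weight l hl b hb0 := by
    simp only [boundaryTerm, d.weight hx hl hb0, d.curve.variation_smul d.isOpen hx hl hb0,
      d.curve_back.variation_smul d.isOpen hx hl hb0, square_eq, Pi.smul_apply, Pi.add_apply,
      smul_eq_mul]
    field_simp

/-- With the field equations the Lagrangian takes a form symmetric in the two families of curves:
`[m ∂̄(F + Fb)] + 2 ((hb + h)(F) - hb(Fb)) Dλ̄`. -/
theorem lagrangian_eq (d : IsDeformation κ₁ κ₂ U T hb h Fb F m M) (hx : x ∈ U) (hl : l ≠ 0)
    (v : Spinor) :
    lagrangian κ₁ κ₂ hb h (Fb x) (m x) l v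
      = (square (F x l - Fb x l) (fun α => wirtinger I (fun l' => F x l' α) l v
            + wirtinger I (fun l' => Fb x l' α) l v)
          + 2 * ((hb (F x l) l + h (F x l) l) - hb (Fb x l) l) * barD l v)
        / (lam1 κ₂ l ^ 2 * lam2 κ₁ l ^ 2) := by
  -- for `P = ∂̄F` and `B = ∂̄Fb` one has `[m (P - B)] - 2 [B m] = [m (P + B)]`
  have hm : m x l = F x l - Fb x l := by rw [d.eq_add x hx l hl]; abel
  have hdm : ∀ α, dbar (fun l' => m x l' α) l v
      = wirtinger I (fun l' => F x l' α) l v - wirtinger I (fun l' => Fb x l' α) l v := by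
    intro α
    rw [← wirtinger_sub ((d.curve.component α).differentiableAt_snd d.isOpen hx hl)
      ((d.curve_back.component α).differentiableAt_snd d.isOpen hx hl), dbar_eq_wirtinger]
    refine wirtinger_congr ?_ v
    filter_upwards [isOpen_compl_singleton.mem_nhds hl] with l' hl'
    rw [d.eq_add x hx l' hl']
    simp
  have hB : ∀ α, wirtinger I (fun l' => Fb x l' α) l v
      = dMuLow (fun μ => hb μ l) (Fb x l) α * barD l v := d.curve_back.curve x hx l hl v
  unfold lagrangian
  rw [sum_dMuUp_mul, ← d.eq_add x hx l hl, hm]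
  simp only [hdm, square_eq, hB, Pi.sub_apply]
  congr 1
  ring

/-- The variation of the Lagrangian is a total derivative. -/
theorem fderiv_affineDensity (d : IsDeformation κ₁ κ₂ U T hb h Fb F m M) (hx : x ∈ U) {w : ℂ}
    (hw : w ≠ 0) :
    DifferentiableAt ℂ
      (fun y => affineDensity κ₁ κ₂ (lagrangian κ₁ κ₂ hb h (Fb y) (m y)) w) x ∧
    ∀ u, fderiv ℂ (fun y => affineDensity κ₁ κ₂ (lagrangian κ₁ κ₂ hb h (Fb y) (m y)) w) x u
      = -2 * I * (dbar (boundaryTerm Fb F M (x, u)) (κ₁ + w • κ₂) κ₂ / w) := by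
  have hl := add_smul_ne_zero d.angle_eq w
  have hl1 : lam1 κ₂ (κ₁ + w • κ₂) = 1 := by simpa using lam1_affine d.angle_eq 1 w
  have hl2 : lam2 κ₁ (κ₁ + w • κ₂) = w := by simpa using lam2_affine d.angle_eq 1 w
  set l := κ₁ + w • κ₂ with hldef
  have hF := fun α : Fin 2 => ((d.curve.component α).holo x hx l hl).hasFDerivAt
  have hFb := fun α : Fin 2 => ((d.curve_back.component α).holo x hx l hl).hasFDerivAt
  have hW := fun α : Fin 2 => ((d.curve.component α).wirtinger_holo d.isOpen hx hl I κ₂).hasFDerivAt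
  have hWb := fun α : Fin 2 =>
    ((d.curve_back.component α).wirtinger_holo d.isOpen hx hl I κ₂).hasFDerivAt
  have hH := d.curve.hasFDerivAt_hamiltonian
    (fun p hp => (d.back.holo p hp).add (d.pert.holo p hp)) hx hl
  have hHb := d.curve_back.hasFDerivAt_hamiltonian d.back.holo hx hl
  have hN := (((((hF 1).sub (hFb 1)).mul ((hW 0).add (hWb 0))).sub
    (((hF 0).sub (hFb 0)).mul ((hW 1).add (hWb 1)))).add
    ((hH.1.hasFDerivAt.sub hHb.1.hasFDerivAt).const_mul (2 * barD l κ₂))).const_mul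
      (-2 * I / w ^ 2)
  have hN' := hN.congr_of_eventuallyEq
    (f₁ := fun y => affineDensity κ₁ κ₂ (lagrangian κ₁ κ₂ hb h (Fb y) (m y)) w) (by
      filter_upwards [d.isOpen.mem_nhds hx] with y hy
      rw [affineDensity, d.lagrangian_eq hy hl, hl1, hl2]
      simp only [square_eq, Pi.sub_apply, Pi.add_apply, Pi.mul_apply]
      ring)
  refine ⟨hN'.differentiableAt, fun u => ?_⟩
  have hg := d.isWeightZero_boundaryTerm hx u
  have hlam : DifferentiableAt ℂ (fun l' => lam1 κ₂ l' * lam2 κ₁ l') l :=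
    (differentiable_lam1 κ₂ l).mul (differentiable_lam2 κ₁ l)
  have hdF := fun α => ((d.curve.component α).dx d.isOpen u).differentiableAt_snd d.isOpen hx hl
  have hdFb := fun α =>
    ((d.curve_back.component α).dx d.isOpen u).differentiableAt_snd d.isOpen hx hl
  have hsF := fun α => (d.curve.component α).differentiableAt_snd d.isOpen hx hl
  have hsFb := fun α => (d.curve_back.component α).differentiableAt_snd d.isOpen hx hl
  -- the factor `λ₁ λ₂` of `m` is holomorphic, so it passes through `∂̄`
  have e1 : wirtinger I (fun l' => square (F x l' - Fb x l')
      (variation F u x l' + variation Fb u x l')) l κ₂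
      = w * wirtinger I (boundaryTerm Fb F M (x, u)) l κ₂ := by
    have : (fun l' => square (F x l' - Fb x l') (variation F u x l' + variation Fb u x l'))
        =ᶠ[𝓝 l] fun l' => (lam1 κ₂ l' * lam2 κ₁ l') * boundaryTerm Fb F M (x, u) l' := by
      filter_upwards [isOpen_compl_singleton.mem_nhds hl] with l' hl'
      rw [d.eq_add x hx l' hl', add_sub_cancel_left, d.eq_smul x hx l' hl']
      simp only [boundaryTerm, square_eq, Pi.smul_apply, smul_eq_mul]
      ring
    rw [wirtinger_congr this, wirtinger_mul (hlam.restrictScalars ℝ) (hg.differentiableAt hl),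
      hl1, hl2, ← dbar_eq_wirtinger, dbar_of_differentiableAt hlam]
    ring
  have e2 := wirtinger_square (s := I) (a := fun l' => F x l' - Fb x l')
    (b := fun l' => variation F u x l' + variation Fb u x l')
    (fun α => (hsF α).sub (hsFb α)) (fun α => (hdF α).add (hdFb α)) κ₂
  have e3 : ∀ α, wirtinger I (fun l' => (F x l' - Fb x l') α) l κ₂
      = wirtinger I (fun l' => F x l' α) l κ₂ - wirtinger I (fun l' => Fb x l' α) l κ₂ :=
    fun α => wirtinger_sub (hsF α) (hsFb α) κ₂
  have e4 : ∀ α, wirtinger I (fun l' => (variation F u x l' + variation Fb u x l') α) l κ₂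
      = wirtinger I (dx (fun y l' => F y l' α) u x) l κ₂
        + wirtinger I (dx (fun y l' => Fb y l' α) u x) l κ₂ :=
    fun α => wirtinger_add (hdF α) (hdFb α) κ₂
  -- the variations of the Hamiltonians are contracted with `∂̄F`, `∂̄Fb` by the curve equations
  have hP : ∀ α, wirtinger I (fun l' => F x l' α) l κ₂
      = dMuLow (fun μ => hb μ l + h μ l) (F x l) α * barD l κ₂ := d.curve.curve x hx l hl κ₂
  have hB : ∀ α, wirtinger I (fun l' => Fb x l' α) l κ₂
      = dMuLow (fun μ => hb μ l) (Fb x l) α * barD l κ₂ := d.curve_back.curve x hx l hl κ₂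
  have e5 : dbar (boundaryTerm Fb F M (x, u)) l κ₂ / w
      = wirtinger I (fun l' => square (F x l' - Fb x l')
      (variation F u x l' + variation Fb u x l')) l κ₂ / w ^ 2 := by
    rw [e1, dbar_eq_wirtinger]; field_simp
  have v1 : ∀ α, fderiv ℂ (fun y => F y l α) x u = variation F u x l α := fun _ => rfl
  have v2 : ∀ α, fderiv ℂ (fun y => Fb y l α) x u = variation Fb u x l α := fun _ => rfl
  have v3 : ∀ α, fderiv ℂ (fun y => wirtinger I (fun l' => F y l' α) l κ₂) x u
      = wirtinger I (dx (fun y l' => F y l' α) u x) l κ₂ := fun α =>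
    (d.curve.component α).fderiv_wirtinger d.isOpen hx hl I κ₂ u
  have v4 : ∀ α, fderiv ℂ (fun y => wirtinger I (fun l' => Fb y l' α) l κ₂) x u
      = wirtinger I (dx (fun y l' => Fb y l' α) u x) l κ₂ := fun α =>
    (d.curve_back.component α).fderiv_wirtinger d.isOpen hx hl I κ₂ u
  rw [e5, e2, hN'.fderiv]
  simp only [e3, e4, square_eq]
  simp only [_root_.smul_apply, _root_.add_apply, _root_.sub_apply, smul_eq_mul, Pi.sub_apply,
    Pi.add_apply, v1, v2, v3, v4, hH.2, hHb.2, square_eq, hP, hB]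
  ring

end IsDeformation

namespace IsDeformation

variable {κ₁ κ₂ : Spinor} {U : Set Point} {T : Set (Spinor × Spinor)}
  {hb h : Spinor → Spinor → ℂ} {Fb F m M : Point → Spinor → Spinor} {x : Point} {l : Spinor}

/-- The variation of the Lagrangian is bounded, locally uniformly in `x`, by an integrable function
of `w`: it has only a simple pole, as the total derivative of a smooth function over `λ₁ λ₂`. -/
theorem exists_bound_fderiv_affineDensity (d : IsDeformation κ₁ κ₂ U T hb h Fb F m M)
    {S : Set Point} (hS : IsCompact S) (hSU : S ⊆ U) :
    ∃ C : ℝ, ∀ y ∈ S, ∀ w : ℂ, w ≠ 0 →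
      ‖fderiv ℂ (fun y => affineDensity κ₁ κ₂ (lagrangian κ₁ κ₂ hb h (Fb y) (m y)) w) y‖
        ≤ C / (‖w‖ * (1 + ‖w‖) ^ 2) := by
  obtain ⟨C, hC⟩ := exists_bound_fderiv_affine (g := boundaryTerm Fb F M)
    (hS.prod (isCompact_closedBall (0 : Point) 1))
    (fun e he => d.isWeightZero_boundaryTerm (hSU he.1) e.2)
    ((continuousOn_fderiv_snd (d.isOpen.prod isOpen_univ) d.contDiffOn_boundaryTerm).mono
      (prod_mono_left (prod_mono hSU (subset_univ _)))) d.angle_eq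
  refine ⟨2 * C, fun y hy w hw => ?_⟩
  have hb : ∀ u : Point, ‖u‖ ≤ 1 →
      ‖fderiv ℂ (fun y => affineDensity κ₁ κ₂ (lagrangian κ₁ κ₂ hb h (Fb y) (m y)) w) y u‖
        ≤ 2 * C / (‖w‖ * (1 + ‖w‖) ^ 2) := by
    intro u hu
    have h1 := hC (y, u) ⟨hy, by simpa using hu⟩ w 1
    have h2 := hC (y, u) ⟨hy, by simpa using hu⟩ w I
    rw [one_smul, norm_one, mul_one] at h1
    rw [norm_I, mul_one] at h2
    have h3 : ‖dbar (boundaryTerm Fb F M (y, u)) (κ₁ + w • κ₂) κ₂‖ ≤ C / (1 + ‖w‖) ^ 2 := by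
      unfold dbar
      rw [norm_div, Complex.norm_ofNat, div_le_iff₀ (by norm_num)]
      refine (norm_add_le _ _).trans ?_
      rw [norm_mul, norm_I, one_mul]
      linarith
    rw [(d.fderiv_affineDensity (hSU hy) hw).2, norm_mul, norm_div]
    calc _ ≤ ‖-2 * I‖ * (C / (1 + ‖w‖) ^ 2 / ‖w‖) := by gcongr
      _ = _ := by
        have hw' := norm_ne_zero_iff.2 hw
        simp; field_simp
  exact ContinuousLinearMap.opNorm_le_of_unit_norm ((norm_nonneg _).trans (hb 0 (by simp)))
    fun u hu => hb u hu.le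

theorem aestronglyMeasurable_fderiv_affineDensity (d : IsDeformation κ₁ κ₂ U T hb h Fb F m M)
    (hx : x ∈ U) : AEStronglyMeasurable (fun w => fderiv ℂ
      (fun y => affineDensity κ₁ κ₂ (lagrangian κ₁ κ₂ hb h (Fb y) (m y)) w) x) := by
  have hcont : ContinuousOn (fun w => fderiv ℂ
      (fun y => affineDensity κ₁ κ₂ (lagrangian κ₁ κ₂ hb h (Fb y) (m y)) w) x) {0}ᶜ := by
    rw [continuousOn_clm_apply]
    intro u
    have hg := d.isWeightZero_boundaryTerm hx u
    have hD : Continuous fun w : ℂ => fderiv ℝ (boundaryTerm Fb F M (x, u)) (κ₁ + w • κ₂) :=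
      (hg.smooth.continuousOn_fderiv_of_isOpen isOpen_compl_singleton le_rfl).comp_continuous
        (by fun_prop) fun w => add_smul_ne_zero d.angle_eq w
    have hd : Continuous fun w : ℂ => dbar (boundaryTerm Fb F M (x, u)) (κ₁ + w • κ₂) κ₂ := by
      unfold dbar; fun_prop
    refine ContinuousOn.congr (f := fun w : ℂ =>
      -2 * I * (dbar (boundaryTerm Fb F M (x, u)) (κ₁ + w • κ₂) κ₂ / w)) ?_
      fun w hw => (d.fderiv_affineDensity hx hw).2 u
    exact continuousOn_const.mul (hd.continuousOn.div continuousOn_id fun w hw => hw)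
  have := hcont.aestronglyMeasurable (μ := volume) (measurableSet_singleton (0 : ℂ)).compl
  rwa [restrict_compl_singleton] at this

theorem boundaryTerm_left (d : IsDeformation κ₁ κ₂ U T hb h Fb F m M) (hx : x ∈ U) (u : Point) :
    boundaryTerm Fb F M (x, u) κ₁ = 2 * square (M x κ₁) u.1 := by
  rw [boundaryTerm, d.curve.variation_eq_fst d.isOpen hx d.left_ne_zero d.curve_left,
    d.curve_back.variation_eq_fst d.isOpen hx d.left_ne_zero d.back_left]
  simp only [square_eq, Pi.add_apply]; ring

theorem boundaryTerm_right (d : IsDeformation κ₁ κ₂ U T hb h Fb F m M) (hx : x ∈ U) (u : Point) :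
    boundaryTerm Fb F M (x, u) κ₂ = 2 * square (M x κ₂) u.2 := by
  rw [boundaryTerm, d.curve.variation_eq_snd d.isOpen hx d.right_ne_zero d.curve_right,
    d.curve_back.variation_eq_snd d.isOpen hx d.right_ne_zero d.back_right]
  simp only [square_eq, Pi.add_apply]; ring

/-- The on-shell action is holomorphic, and its derivatives are the values of `M` at `κ₁`, `κ₂`. -/
theorem fderiv_action (d : IsDeformation κ₁ κ₂ U T hb h Fb F m M)
    (hS : ∀ x ∈ U, Integrable (affineDensity κ₁ κ₂ (lagrangian κ₁ κ₂ hb h (Fb x) (m x))))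
    (hbar : ℂ) (hx : x ∈ U) :
    DifferentiableAt ℂ (fun y => action κ₁ κ₂ hbar hb h (Fb y) (m y)) x ∧
    ∀ u, fderiv ℂ (fun y => action κ₁ κ₂ hbar hb h (Fb y) (m y)) x u
      = 1 / hbar * (4 * Real.pi * I * (square (M x κ₁) u.1 - square (M x κ₂) u.2)) := by
  obtain ⟨r, hr, hrU⟩ := Metric.nhds_basis_closedBall.mem_iff.1 (d.isOpen.mem_nhds hx)
  obtain ⟨C, hC⟩ := d.exists_bound_fderiv_affineDensity (isCompact_closedBall x r) hrU
  have hne : ∀ᵐ w : ℂ, w ≠ 0 := Measure.ae_ne volume 0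
  have hmeas := d.aestronglyMeasurable_fderiv_affineDensity hx
  have hint := integrable_norm_mul_one_add_sq_inv C
  have hder := hasFDerivAt_integral_of_dominated_of_fderiv_le
    (F := fun y w => affineDensity κ₁ κ₂ (lagrangian κ₁ κ₂ hb h (Fb y) (m y)) w)
    (F' := fun y w => fderiv ℂ
      (fun y => affineDensity κ₁ κ₂ (lagrangian κ₁ κ₂ hb h (Fb y) (m y)) w) y)
    (Metric.closedBall_mem_nhds x hr)
    (by filter_upwards [d.isOpen.mem_nhds hx] with y hy using (hS y hy).aestronglyMeasurable)
    (hS x hx) hmeas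
    (by filter_upwards [hne] with w hw y hy using hC y hy w hw) hint
    (by filter_upwards [hne] with w hw y hy using
          (d.fderiv_affineDensity (hrU hy) hw).1.hasFDerivAt)
  have hder' := hder.const_mul (1 / hbar)
  refine ⟨hder'.differentiableAt, fun u => ?_⟩
  have hFint : Integrable (fun w => fderiv ℂ
      (fun y => affineDensity κ₁ κ₂ (lagrangian κ₁ κ₂ hb h (Fb y) (m y)) w) x) :=
    hint.mono' hmeas (by
      filter_upwards [hne] with w hw using hC x (Metric.mem_closedBall_self hr.le) w hw)
  have hval : (∫ w, fderiv ℂ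
      (fun y => affineDensity κ₁ κ₂ (lagrangian κ₁ κ₂ hb h (Fb y) (m y)) w) x) u
      = 4 * Real.pi * I * (square (M x κ₁) u.1 - square (M x κ₂) u.2) := by
    rw [ContinuousLinearMap.integral_apply hFint]
    have : ∀ᵐ w : ℂ, fderiv ℂ
        (fun y => affineDensity κ₁ κ₂ (lagrangian κ₁ κ₂ hb h (Fb y) (m y)) w) x u
        = -2 * I * (dbar (boundaryTerm Fb F M (x, u)) (κ₁ + w • κ₂) κ₂ / w) := by
      filter_upwards [hne] with w hw using (d.fderiv_affineDensity hx hw).2 u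
    rw [integral_congr_ae this, integral_const_mul,
      integral_dbar_affine (d.isWeightZero_boundaryTerm hx u) d.angle_eq,
      d.boundaryTerm_left hx, d.boundaryTerm_right hx]
    ring
  rw [← hval]
  exact congrArg (fun L : Point →L[ℂ] ℂ => L u) hder'.fderiv

end IsDeformation

/-! ### Holomorphic functions of weight two on the projective line -/

/-- A holomorphic section of `𝒪(2)` is a quadratic polynomial, by Liouville's theorem for the second
divided difference in the affine coordinate. -/
theorem eq_quadratic_of_weight_two {σ : Spinor → ℂ}
    (hσ : ∀ l : Spinor, l ≠ 0 → DifferentiableAt ℂ σ l)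
    (hw : ∀ l : Spinor, l ≠ 0 → ∀ b : ℂ, b ≠ 0 → σ (b • l) = b ^ 2 * σ l)
    {κ₁ κ₂ : Spinor} (hκ : angle κ₁ κ₂ = 1) {l : Spinor} (hl : l ≠ 0) :
    σ l = lam1 κ₂ l ^ 2 * σ κ₁ + lam1 κ₂ l * lam2 κ₁ l * fderiv ℂ σ κ₁ κ₂
      + lam2 κ₁ l ^ 2 * σ κ₂ := by
  set q : ℂ → ℂ := fun w => σ (κ₁ + w • κ₂) with hq
  have hline : ∀ w : ℂ, HasDerivAt (fun w : ℂ => κ₁ + w • κ₂) κ₂ w := fun w => by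
    simpa using ((hasDerivAt_id w).smul_const κ₂).const_add κ₁
  have hqd : ∀ w, HasDerivAt q (fderiv ℂ σ (κ₁ + w • κ₂) κ₂) w := fun w =>
    (hσ _ (add_smul_ne_zero hκ w)).hasFDerivAt.comp_hasDerivAt w (hline w)
  have hdq : Differentiable ℂ q := fun w => (hqd w).differentiableAt
  have hds : ∀ f : ℂ → ℂ, Differentiable ℂ f → Differentiable ℂ (dslope f 0) := fun f hf =>
    differentiableOn_univ.1 ((differentiableOn_dslope univ_mem).2 hf.differentiableOn)
  have hd0 : deriv q 0 = fderiv ℂ σ κ₁ κ₂ := by simpa using (hqd 0).deriv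
  have h2 : ∀ w : ℂ, w ≠ 0 → dslope (dslope q 0) 0 w
      = q w / w ^ 2 - q 0 * w⁻¹ ^ 2 - fderiv ℂ σ κ₁ κ₂ * w⁻¹ := by
    intro w hw0
    rw [dslope_of_ne _ hw0, slope_def_field, dslope_of_ne _ hw0, slope_def_field, dslope_same, hd0]
    field_simp
    ring
  have hlim : Tendsto (dslope (dslope q 0) 0) (cocompact ℂ) (𝓝 (σ κ₂)) := by
    rw [← Metric.cobounded_eq_cocompact]
    have hi := tendsto_inv₀_cobounded (α := ℂ)
    have h1 : Tendsto (fun w : ℂ => w⁻¹ • κ₁ + κ₂) (Bornology.cobounded ℂ) (𝓝 κ₂) := by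
      simpa using (hi.smul_const κ₁).add_const κ₂
    have h3 := (((hσ _ (ne_zero_of_angle_right hκ)).continuousAt.tendsto.comp h1).sub
      ((hi.pow 2).const_mul (q 0))).sub (hi.const_mul (fderiv ℂ σ κ₁ κ₂))
    simp only [ne_eq, OfNat.ofNat_ne_zero, not_false_eq_true, zero_pow, mul_zero, sub_zero] at h3
    refine h3.congr' ?_
    filter_upwards [Bornology.eventually_ne_cobounded (0 : ℂ)] with w hw0
    rw [h2 w hw0, Function.comp_apply]
    have := hw _ (smul_add_ne_zero hκ w⁻¹) w hw0
    rw [smul_add, smul_inv_smul₀ hw0] at this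
    simp only [hq, this]
    field_simp
  have hquad : ∀ w, q w = q 0 + w * fderiv ℂ σ κ₁ κ₂ + w ^ 2 * σ κ₂ := by
    intro w
    rcases eq_or_ne w 0 with rfl | hw0
    · simp
    have := (hds _ (hds _ hdq)).apply_eq_of_tendsto_cocompact w hlim
    rw [h2 w hw0] at this
    rw [← this]
    field_simp
    ring
  rcases eq_or_ne (lam1 κ₂ l) 0 with h0 | h0
  · have hdec := lam_decomp hκ l
    rw [h0, zero_smul, zero_add] at hdec
    have hne : lam2 κ₁ l ≠ 0 := fun h => hl (by rw [hdec, h, zero_smul])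
    have := hw _ (ne_zero_of_angle_right hκ) _ hne
    rw [← hdec] at this
    rw [this, h0]; ring
  · have hdec : l = lam1 κ₂ l • (κ₁ + (lam2 κ₁ l / lam1 κ₂ l) • κ₂) := by
      rw [smul_add, smul_smul, mul_div_cancel₀ _ h0]; exact lam_decomp hκ l
    have := hw _ (add_smul_ne_zero hκ (lam2 κ₁ l / lam1 κ₂ l)) _ h0
    rw [← hdec] at this
    have hqq := hquad (lam2 κ₁ l / lam1 κ₂ l)
    simp only [hq, zero_smul, add_zero] at hqq
    rw [this, hqq]
    field_simp

/-! ### The two-forms of the space-time of a family of curves -/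

theorem IsHamiltonian.add {T : Set (Spinor × Spinor)} {f g : Spinor → Spinor → ℂ}
    (hf : IsHamiltonian T f) (hg : IsHamiltonian T g) :
    IsHamiltonian T (fun μ l => f μ l + g μ l) where
  smooth := hf.smooth.add hg.smooth
  holo p hp := (hf.holo p hp).add (hg.holo p hp)
  weight p hp b hb := by rw [hf.weight p hp b hb, hg.weight p hp b hb, mul_add]

theorem wedgeSelf_eq (p q : Spinor) : wedgeSelf p q = 2 * square p q := by
  simp [wedgeSelf, square_eq, lower]; ring

namespace IsCurveFamily

variable {U : Set Point} {T : Set (Spinor × Spinor)} {h : Spinor → Spinor → ℂ}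
  {F : Point → Spinor → Spinor} {x : Point} {l : Spinor}

theorem isHoloFamily_hamiltonian (hF : IsCurveFamily U T h F) (hh : IsHamiltonian T h) :
    IsHoloFamily U (fun x l => h (F x l) l) where
  smooth := hh.smooth.comp (hF.smooth.prodMk contDiffOn_snd) fun p hp => hF.mem p.1 hp.1 p.2 hp.2
  holo _ hx _ hl := (hF.hasFDerivAt_hamiltonian hh.holo hx hl).1

/-- The two-form `[δ_u F δ_v F]` is holomorphic in `λ`: as `[∂̄F δ_v F]` is the derivative of the
Hamiltonian on the curves along `v`, this is the symmetry of second derivatives in `x`. -/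
theorem dbar_square_variation (hF : IsCurveFamily U T h F) (hh : IsHamiltonian T h)
    (hU : IsOpen U) (hx : x ∈ U) (hl : l ≠ 0) (u v : Point) (w : Spinor) :
    dbar (fun l => square (variation F u x l) (variation F v x l)) l w = 0 := by
  -- `δ_u` of `[∂̄F δ_v F] = δ_v h|_F Dλ̄`
  have key : ∀ u v : Point,
      barD l w * dx (dx (fun x l => h (F x l) l) v) u x l
        = square (fun α => wirtinger I (fun l' => variation F u x l' α) l w) (variation F v x l)
          + square (fun α => wirtinger I (fun l' => F x l' α) l w)
            (fun α => dx (dx (fun x l => F x l α) v) u x l) := by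
    intro u v
    have e : (fun y => barD l w * dx (fun x l => h (F x l) l) v y l) =ᶠ[𝓝 x]
        fun y => square (fun α => wirtinger I (fun l' => F y l' α) l w) (variation F v y l) := by
      filter_upwards [hU.mem_nhds hx] with y hy
      have hW : ∀ α, wirtinger I (fun l' => F y l' α) l w
          = dMuLow (fun μ => h μ l) (F y l) α * barD l w := hF.curve y hy l hl w
      simp only [dx, (hF.hasFDerivAt_hamiltonian hh.holo hy hl).2 v, square_eq, hW]
      ring
    have h1 := ((hF.isHoloFamily_hamiltonian hh).dx hU v).holo x hx l hl
    have hW := fun α : Fin 2 => ((hF.component α).wirtinger_holo hU hx hl I w).hasFDerivAt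
    have hV := fun α : Fin 2 => (((hF.component α).dx hU v).holo x hx l hl).hasFDerivAt
    have e1 := congrArg (fun L : Point →L[ℂ] ℂ => L u)
      (h1.hasFDerivAt.const_mul (barD l w)).fderiv
    have e2 := congrArg (fun L : Point →L[ℂ] ℂ => L u)
      ((((hW 1).fun_mul (hV 0)).fun_sub ((hW 0).fun_mul (hV 1))).fderiv)
    have v1 : ∀ α, fderiv ℂ (fun y => wirtinger I (fun l' => F y l' α) l w) x u
        = wirtinger I (fun l' => variation F u x l' α) l w := fun α =>
      (hF.component α).fderiv_wirtinger hU hx hl I w u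
    have e0 := congrArg (fun L : Point →L[ℂ] ℂ => L u) e.fderiv_eq
    simp only [square_eq, variation] at e0
    simp only [_root_.smul_apply, _root_.add_apply, _root_.sub_apply, smul_eq_mul, v1] at e1 e2
    rw [e1, e2] at e0
    simp only [square_eq, variation] at e0 ⊢
    simp only [dx] at e0 ⊢
    linear_combination e0
  have h1 := key u v
  have h2 := key v u
  rw [(hF.isHoloFamily_hamiltonian hh).dx_comm hU hx hl] at h1
  simp only [(hF.component _).dx_comm hU hx hl v u] at h1
  have hd := fun (u : Point) (α : Fin 2) =>
    ((hF.component α).dx hU u).differentiableAt_snd hU hx hl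
  rw [dbar_eq_wirtinger,
    wirtinger_square (a := variation F u x) (b := variation F v x) (hd u) (hd v)]
  simp only [square_eq] at h1 h2 ⊢
  linear_combination h2 - h1

theorem differentiableAt_square_variation (hF : IsCurveFamily U T h F) (hh : IsHamiltonian T h)
    (hU : IsOpen U) (hx : x ∈ U) (hl : l ≠ 0) (u v : Point) :
    DifferentiableAt ℂ (fun l => square (variation F u x l) (variation F v x l)) l := by
  refine differentiableAt_of_dbar_eq_zero ?_ (hF.dbar_square_variation hh hU hx hl u v)
  have hd := fun (u : Point) (α : Fin 2) =>
    ((hF.component α).dx hU u).differentiableAt_snd hU hx hl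
  simp only [square_eq]
  exact ((hd u 1).mul (hd v 0)).sub ((hd u 0).mul (hd v 1))

/-- The two-form of a family of curves, from its boundary values and the first coefficient of the
curves at `κ₁`. -/
theorem sigmaForm_eq (hF : IsCurveFamily U T h F) (hh : IsHamiltonian T h) (hU : IsOpen U)
    {κ₁ κ₂ : Spinor} (hκ : angle κ₁ κ₂ = 1) (hz : ∀ x ∈ U, F x κ₁ = x.1)
    (hzt : ∀ x ∈ U, F x κ₂ = x.2) (hx : x ∈ U) (hl : l ≠ 0) (u v : Point) :
    sigmaForm F x l u v = 2 * (lam1 κ₂ l ^ 2 * square u.1 v.1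
      + lam1 κ₂ l * lam2 κ₁ l *
        (square (fun α => fderiv ℂ (fun y => del (fun l => F y l α) κ₁ κ₂) x u) v.1
          + square u.1 (fun α => fderiv ℂ (fun y => del (fun l => F y l α) κ₁ κ₂) x v))
      + lam2 κ₁ l ^ 2 * square u.2 v.2) := by
  have h1 := ne_zero_of_angle_left hκ
  have h2 := ne_zero_of_angle_right hκ
  have hquad := eq_quadratic_of_weight_two
    (fun l hl => hF.differentiableAt_square_variation hh hU hx hl u v)
    (fun l hl b hb => by
      rw [hF.variation_smul hU hx hl hb, hF.variation_smul hU hx hl hb]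
      simp only [square_eq, Pi.smul_apply, smul_eq_mul]; ring) hκ hl
  have hd := fun (u : Point) (α : Fin 2) =>
    ((hF.component α).dx hU u).differentiableAt_snd hU hx h1
  have hdel : ∀ (u : Point) (α : Fin 2), wirtinger (-I) (fun l' => variation F u x l' α) κ₁ κ₂
      = fderiv ℂ (fun y => del (fun l => F y l α) κ₁ κ₂) x u := fun u α => by
    rw [del_eq_wirtinger]
    exact ((hF.component α).fderiv_wirtinger hU hx h1 (-I) κ₂ u).symm
  rw [← del_of_differentiableAt (hF.differentiableAt_square_variation hh hU hx h1 u v),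
    del_eq_wirtinger,
    wirtinger_square (a := variation F u x) (b := variation F v x) (hd u) (hd v),
    hF.variation_eq_fst hU hx h1 hz, hF.variation_eq_fst hU hx h1 hz, hF.variation_eq_snd hU hx h2 hzt,
    hF.variation_eq_snd hU hx h2 hzt] at hquad
  simp only [hdel] at hquad
  rw [sigmaForm, wedgeSelf_eq, hF.fderiv_eq_variation hx hl, hF.fderiv_eq_variation hx hl, hquad]

end IsCurveFamily

/-! ### Kähler potentials -/

theorem clm_apply_eq_sum (L : Point →L[ℂ] ℂ) (u : Point) :
    L u = (∑ α, u.1 α * L (Pi.single α 1, 0)) + ∑ α, u.2 α * L (0, Pi.single α 1) := by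
  have hu : u = (∑ α, u.1 α • ((Pi.single α 1, 0) : Point))
      + ∑ α, u.2 α • ((0, Pi.single α 1) : Point) := by
    ext i <;> fin_cases i <;> simp
  conv_lhs => rw [hu]
  simp only [map_add, map_sum, map_smul, smul_eq_mul]

/-- Symmetry of the second `z`-derivatives, for which all first derivatives have to be
differentiable. -/
theorem dZ_comm {Ω : Point → ℂ} {U : Set Point} (hU : IsOpen U) (hΩ : DifferentiableOn ℂ Ω U)
    {x : Point} (hx : x ∈ U) (h1 : ∀ α, DifferentiableAt ℂ (fun y => dZ Ω y α) x)
    (h2 : ∀ α, DifferentiableAt ℂ (fun y => dZt Ω y α) x) (α β : Fin 2) :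
    dZ (fun y => dZ Ω y α) x β = dZ (fun y => dZ Ω y β) x α := by
  let E : Fin 2 → Point →L[ℂ] ℂ := fun α =>
    (ContinuousLinearMap.proj α).comp (ContinuousLinearMap.fst ℂ Spinor Spinor)
  let Et : Fin 2 → Point →L[ℂ] ℂ := fun α =>
    (ContinuousLinearMap.proj α).comp (ContinuousLinearMap.snd ℂ Spinor Spinor)
  have hf : ∀ᶠ y in 𝓝 x, HasFDerivAt Ω
      ((∑ α, dZ Ω y α • E α) + ∑ α, dZt Ω y α • Et α) y := by
    filter_upwards [hU.mem_nhds hx] with y hy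
    have := (hΩ.differentiableAt (hU.mem_nhds hy)).hasFDerivAt
    convert this using 1
    refine ContinuousLinearMap.ext fun u => ?_
    rw [clm_apply_eq_sum (fderiv ℂ Ω y) u]
    simp [E, Et, dZ, dZt, mul_comm]
  have hf' := (HasFDerivAt.fun_sum (u := Finset.univ)
      fun α _ => (h1 α).hasFDerivAt.smul_const (E α)).fun_add
    (HasFDerivAt.fun_sum (u := Finset.univ) fun α _ => (h2 α).hasFDerivAt.smul_const (Et α))
  have := second_derivative_symmetric_of_eventually hf hf' (Pi.single β 1, 0) (Pi.single α 1, 0)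
  fin_cases α <;> fin_cases β <;>
    first | rfl | simpa [E, Et, Fin.sum_univ_two, dZ] using this

/-- The conditions on first derivatives characterise Kähler potentials: the form of `Σ(x, λ)`
follows since it is quadratic in `λ`, and the heavenly equation is the Plücker relation, as
`Σ(x, λ)` is decomposable. -/
theorem IsCurveFamily.isKahlerPotential {U : Set Point} {T : Set (Spinor × Spinor)}
    {h : Spinor → Spinor → ℂ} {F : Point → Spinor → Spinor} (hF : IsCurveFamily U T h F)
    (hh : IsHamiltonian T h) (hU : IsOpen U) {κ₁ κ₂ : Spinor} (hκ : angle κ₁ κ₂ = 1)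
    (hz : ∀ x ∈ U, F x κ₁ = x.1) (hzt : ∀ x ∈ U, F x κ₂ = x.2) {Ω : Point → ℂ}
    (hΩ : DifferentiableOn ℂ Ω U)
    (h1 : ∀ x ∈ U, ∀ α, dZ Ω x α = lower (fun β => del (fun l => F x l β) κ₁ κ₂) α)
    (h2 : ∀ x ∈ U, ∀ α, dZt Ω x α = -lower (fun β => del (fun l => F x l β) κ₂ κ₁) α) :
    IsKahlerPotential U κ₁ κ₂ F Ω := by
  have hk1 := ne_zero_of_angle_left hκ
  have hk2 := ne_zero_of_angle_right hκ
  have hdel1 : ∀ x ∈ U, ∀ β, DifferentiableAt ℂ (fun y => del (fun l => F y l β) κ₁ κ₂) x :=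
    fun x hx β => by
      rw [del_eq_wirtinger]; exact (hF.component β).wirtinger_holo hU hx hk1 _ _
  have hdel2 : ∀ x ∈ U, ∀ β, DifferentiableAt ℂ (fun y => del (fun l => F y l β) κ₂ κ₁) x :=
    fun x hx β => by
      rw [del_eq_wirtinger]; exact (hF.component β).wirtinger_holo hU hx hk2 _ _
  have e1 : ∀ x ∈ U, ∀ α, (fun y => dZ Ω y α) =ᶠ[𝓝 x]
      fun y => lower (fun β => del (fun l => F y l β) κ₁ κ₂) α := fun x hx α => by
    filter_upwards [hU.mem_nhds hx] with y hy using h1 y hy α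
  have e2 : ∀ x ∈ U, ∀ α, (fun y => dZt Ω y α) =ᶠ[𝓝 x]
      fun y => -lower (fun β => del (fun l => F y l β) κ₂ κ₁) α := fun x hx α => by
    filter_upwards [hU.mem_nhds hx] with y hy using h2 y hy α
  have d1 : ∀ x ∈ U, ∀ α, DifferentiableAt ℂ (fun y => dZ Ω y α) x := fun x hx α => by
    refine DifferentiableAt.congr_of_eventuallyEq ?_ (e1 x hx α)
    fin_cases α
    · exact (hdel1 x hx 1).neg
    · exact hdel1 x hx 0
  have d2 : ∀ x ∈ U, ∀ α, DifferentiableAt ℂ (fun y => dZt Ω y α) x := fun x hx α => by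
    refine DifferentiableAt.congr_of_eventuallyEq ?_ (e2 x hx α)
    fin_cases α
    · exact (hdel2 x hx 1).neg.neg
    · exact (hdel2 x hx 0).neg
  -- `F^α = λ₁ z^α + λ₂ Ω^α + ⋯` at `κ₁`, so the middle coefficient is `2 dz^α ∧ dΩ_α`
  have htwo : ∀ x ∈ U, ∀ l : Spinor, l ≠ 0 → ∀ u v : Point,
      sigmaForm F x l u v =
        lam1 κ₂ l ^ 2 * wedgeSelf u.1 v.1
        + 2 * lam1 κ₂ l * lam2 κ₁ l *
          ∑ α, ∑ β, mixedHessian Ω x α β * (u.1 α * v.2 β - v.1 α * u.2 β)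
        + lam2 κ₁ l ^ 2 * wedgeSelf u.2 v.2 := by
    intro x hx l hl u v
    have f0 : ∀ u, fderiv ℂ (fun y => dZ Ω y 0) x u
        = -fderiv ℂ (fun y => del (fun l => F y l 1) κ₁ κ₂) x u := fun u => by
      rw [(e1 x hx 0).fderiv_eq]
      exact congrArg (fun L : Point →L[ℂ] ℂ => L u) fderiv_fun_neg
    have f1 : ∀ u, fderiv ℂ (fun y => dZ Ω y 1) x u
        = fderiv ℂ (fun y => del (fun l => F y l 0) κ₁ κ₂) x u := fun u => by
      rw [(e1 x hx 1).fderiv_eq]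
      rfl
    -- the `dz ∧ dz` part of `dz^α ∧ dΩ_α` drops out by symmetry
    have hs := dZ_comm hU hΩ hx (d1 x hx) (d2 x hx) 0 1
    rw [hF.sigmaForm_eq hh hU hκ hz hzt hx hl, wedgeSelf_eq, wedgeSelf_eq]
    have g0 := fun u => (neg_eq_iff_eq_neg.2 (f0 u)).symm
    simp only [square_eq, g0, ← f1]
    rw [clm_apply_eq_sum (fderiv ℂ (fun y => dZ Ω y 0) x) u,
      clm_apply_eq_sum (fderiv ℂ (fun y => dZ Ω y 0) x) v,
      clm_apply_eq_sum (fderiv ℂ (fun y => dZ Ω y 1) x) u,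
      clm_apply_eq_sum (fderiv ℂ (fun y => dZ Ω y 1) x) v]
    simp only [mixedHessian, Matrix.of_apply, Fin.sum_univ_two, dZt]
    change fderiv ℂ (fun y => dZ Ω y 0) x (Pi.single 1 1, 0)
      = fderiv ℂ (fun y => dZ Ω y 1) x (Pi.single 0 1, 0) at hs
    rw [hs]
    ring
  refine ⟨hΩ, h1, h2, htwo, fun x hx => ?_⟩
  have hl : κ₁ + κ₂ ≠ 0 := by simpa using add_smul_ne_zero hκ 1
  have hl1 : lam1 κ₂ (κ₁ + κ₂) = 1 := by simpa using lam1_affine hκ 1 1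
  have hl2 : lam2 κ₁ (κ₁ + κ₂) = 1 := by simpa using lam2_affine hκ 1 1
  have hs := htwo x hx _ hl
  simp only [sigmaForm, wedgeSelf_eq, hl1, hl2] at hs
  have s1 := hs (Pi.single 0 1, 0) (Pi.single 1 1, 0)
  have s2 := hs (0, Pi.single 0 1) (0, Pi.single 1 1)
  have s3 := fun α β => hs (Pi.single α 1, 0) (0, Pi.single β 1)
  have s00 := s3 0 0
  have s01 := s3 0 1
  have s10 := s3 1 0
  have s11 := s3 1 1
  simp [square_eq, Fin.sum_univ_two] at s1 s2 s00 s01 s10 s11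
  generalize fderiv ℂ (fun y => F y (κ₁ + κ₂)) x = L at *
  generalize L (Pi.single 0 1, 0) = a at *
  generalize L (Pi.single 1 1, 0) = b at *
  generalize L (0, Pi.single 0 1) = c at *
  generalize L (0, Pi.single 1 1) = e at *
  rw [Matrix.det_fin_two, ← s00, ← s01, ← s10, ← s11]
  -- the Plücker relation `[a c][b e] - [a e][b c] = [a b][c e]`
  linear_combination (c 1 * e 0 - c 0 * e 1) / 2 * s1 - s2 / 2

/-- The shift of the next coefficient of the curves at a point where `m` vanishes. -/
theorem IsDeformation.del_curve {κ₁ κ₂ : Spinor} {U : Set Point} {T : Set (Spinor × Spinor)}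
    {hb h : Spinor → Spinor → ℂ} {Fb F m M : Point → Spinor → Spinor} {x : Point} {l : Spinor}
    (d : IsDeformation κ₁ κ₂ U T hb h Fb F m M) (hx : x ∈ U) (hl : l ≠ 0)
    (h0 : lam1 κ₂ l * lam2 κ₁ l = 0) (v : Spinor) (β : Fin 2) :
    del (fun l => F x l β) l v = del (fun l => Fb x l β) l v
      + (lam1 κ₂ l * lam2 κ₁ v + lam2 κ₁ l * lam1 κ₂ v) * M x l β := by
  have hlam : DifferentiableAt ℂ (fun l' => lam1 κ₂ l' * lam2 κ₁ l') l :=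
    (differentiable_lam1 κ₂ l).fun_mul (differentiable_lam2 κ₁ l)
  have hdlam : del (fun l' => lam1 κ₂ l' * lam2 κ₁ l') l v
      = lam1 κ₂ l * lam2 κ₁ v + lam2 κ₁ l * lam1 κ₂ v := by
    rw [del_of_differentiableAt hlam, fderiv_fun_mul (differentiable_lam1 κ₂ l)
      (differentiable_lam2 κ₁ l)]
    simp only [_root_.add_apply, _root_.smul_apply, smul_eq_mul, fderiv_lam1, fderiv_lam2]
  have hMd : DifferentiableAt ℝ (fun l' => M x l' β) l :=
    differentiableAt_pi.1 (((d.contDiffOn_snd hx).contDiffAt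
      (isOpen_compl_singleton.mem_nhds hl)).differentiableAt (by simp)) β
  have e : (fun l' => F x l' β) =ᶠ[𝓝 l]
      fun l' => Fb x l' β + (lam1 κ₂ l' * lam2 κ₁ l') * M x l' β := by
    filter_upwards [isOpen_compl_singleton.mem_nhds hl] with l' hl'
    rw [d.eq_add x hx l' hl', d.eq_smul x hx l' hl']
    rfl
  rw [← hdlam, del_eq_wirtinger, wirtinger_congr e,
    wirtinger_add ((d.curve_back.component β).differentiableAt_snd d.isOpen hx hl)
      ((hlam.restrictScalars ℝ).fun_mul hMd),
    wirtinger_mul (hlam.restrictScalars ℝ) hMd, h0]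
  ring

/-- The first derivatives determine a Kähler potential up to a constant. -/
theorem IsKahlerPotential.exists_eq_add {U : Set Point} {κ₁ κ₂ : Spinor}
    {F : Point → Spinor → Spinor} {K K' : Point → ℂ} (hU : IsOpen U) (hUc : IsPreconnected U)
    (hK : IsKahlerPotential U κ₁ κ₂ F K) (hK' : IsKahlerPotential U κ₁ κ₂ F K') :
    ∃ c : ℂ, ∀ x ∈ U, K' x = K x + c := by
  refine hU.exists_eq_add_of_fderiv_eq hUc hK'.holo hK.holo fun x hx => ?_
  have h1 : ∀ α, dZ K' x α = dZ K x α := fun α => by rw [hK.deriv_z x hx, hK'.deriv_z x hx]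
  have h2 : ∀ α, dZt K' x α = dZt K x α := fun α => by rw [hK.deriv_zt x hx, hK'.deriv_zt x hx]
  refine ContinuousLinearMap.ext fun u => ?_
  rw [clm_apply_eq_sum, clm_apply_eq_sum]
  simp only [dZ, dZt] at h1 h2
  simp only [h1, h2]

end TwistorSigma

end

open TwistorSigma in
theorem mainTheorem2
    -- the spinor basis of the boundary conditions, and the book-keeping parameter
    (κ₁ κ₂ : TwistorSigma.Spinor) (hκ : TwistorSigma.angle κ₁ κ₂ = 1)
    (hbar : ℂ) (hbar_ne : hbar ≠ 0)
    -- the space-time region and the twistor region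
    (U : Set TwistorSigma.Point) (hU : IsOpen U) (hUc : IsPreconnected U)
    (T : Set (TwistorSigma.Spinor × TwistorSigma.Spinor)) (hT : TwistorSigma.IsTwistorRegion T)
    -- the background Hamiltonian and its perturbation
    (hb h : TwistorSigma.Spinor → TwistorSigma.Spinor → ℂ)
    (hhb : TwistorSigma.IsHamiltonian T hb) (hh : TwistorSigma.IsHamiltonian T h)
    -- the background curves, with the coordinates `(z, z̃)`, and the deformed curves
    (Fb F : TwistorSigma.Point → TwistorSigma.Spinor → TwistorSigma.Spinor)
    (hFb : TwistorSigma.IsCurveFamily U T hb Fb)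
    (hz : ∀ x ∈ U, Fb x κ₁ = x.1) (hzt : ∀ x ∈ U, Fb x κ₂ = x.2)
    (hF : TwistorSigma.IsCurveFamily U T (fun μ l => hb μ l + h μ l) F)
    -- the boundary conditions: `F = Fb + m` with `m = λ₁ λ₂ M`, where `M` is regular
    (m M : TwistorSigma.Point → TwistorSigma.Spinor → TwistorSigma.Spinor)
    (hm : ∀ x ∈ U, ∀ l : TwistorSigma.Spinor, l ≠ 0 → F x l = Fb x l + m x l)
    (hmM : ∀ x ∈ U, ∀ l : TwistorSigma.Spinor, l ≠ 0 →
      m x l = (TwistorSigma.lam1 κ₂ l * TwistorSigma.lam2 κ₁ l) • M x l)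
    (hM : ContDiffOn ℝ ∞
      (fun p : TwistorSigma.Point × TwistorSigma.Spinor => M p.1 p.2) (U ×ˢ {0}ᶜ))
    -- the action integral converges
    (hS : ∀ x ∈ U, MeasureTheory.Integrable (TwistorSigma.affineDensity κ₁ κ₂
      (TwistorSigma.lagrangian κ₁ κ₂ hb h (Fb x) (m x))))
    -- the background Kähler potential
    (K : TwistorSigma.Point → ℂ) (hK : TwistorSigma.IsKahlerPotential U κ₁ κ₂ Fb K)
    -- the combination of `K` with the on-shell action
    (Ω : TwistorSigma.Point → ℂ)
    (hΩ : ∀ x, Ω x = K x - hbar / (4 * Real.pi * Complex.I) *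
      TwistorSigma.action κ₁ κ₂ hbar hb h (Fb x) (m x)) :
    TwistorSigma.IsKahlerPotential U κ₁ κ₂ F Ω ∧
    (∀ x ∈ U, ∀ α,
      TwistorSigma.dZ Ω x α = TwistorSigma.dZ K x α + TwistorSigma.lower (M x κ₁) α ∧
      TwistorSigma.dZt Ω x α = TwistorSigma.dZt K x α - TwistorSigma.lower (M x κ₂) α) ∧
    (∀ Ω' : TwistorSigma.Point → ℂ, TwistorSigma.IsKahlerPotential U κ₁ κ₂ F Ω' →
      ∃ c : ℂ, ∀ x ∈ U, Ω' x = Ω x + c) := by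
  have d : IsDeformation κ₁ κ₂ U T hb h Fb F m M :=
    ⟨hκ, hU, hhb, hh, hFb, hz, hzt, hF, hm, hmM, hM⟩
  have l12 : lam2 κ₁ κ₂ = 1 := hκ
  have l21 : lam1 κ₂ κ₁ = 1 := hκ
  have l11 : lam2 κ₁ κ₁ = 0 := by simp [lam2, angle, mul_comm]
  have l22 : lam1 κ₂ κ₂ = 0 := by simp [lam1, angle, mul_comm]
  obtain rfl : Ω = fun x => K x - hbar / (4 * Real.pi * Complex.I) *
      action κ₁ κ₂ hbar hb h (Fb x) (m x) := funext hΩ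
  have hder : ∀ x ∈ U, HasFDerivAt (𝕜 := ℂ) (fun x => K x - hbar / (4 * Real.pi * Complex.I) *
      action κ₁ κ₂ hbar hb h (Fb x) (m x)) _ x := fun x hx =>
    (hK.holo.differentiableAt (hU.mem_nhds hx)).hasFDerivAt.sub
      ((d.fderiv_action hS hbar hx).1.hasFDerivAt.const_mul _)
  have hval : ∀ x ∈ U, ∀ u, fderiv ℂ (fun x => K x - hbar / (4 * Real.pi * Complex.I) *
      action κ₁ κ₂ hbar hb h (Fb x) (m x)) x u
      = fderiv ℂ K x u - (square (M x κ₁) u.1 - square (M x κ₂) u.2) := by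
    intro x hx u
    have hpi : (Real.pi : ℂ) ≠ 0 := Complex.ofReal_ne_zero.2 Real.pi_ne_zero
    rw [(hder x hx).fderiv, _root_.sub_apply, _root_.smul_apply,
      (d.fderiv_action hS hbar hx).2, smul_eq_mul]
    field_simp [Complex.I_ne_zero]
  have hsq : ∀ (a : Spinor) (α : Fin 2), square a (Pi.single α 1) = -lower a α := by
    intro a α
    fin_cases α <;> simp [square_eq, lower]
  have hsq0 : ∀ a : Spinor, square a 0 = 0 := fun a => by simp [square_eq]
  have hfirst : ∀ x ∈ U, ∀ α,
      dZ (fun x => K x - hbar / (4 * Real.pi * Complex.I) *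
        action κ₁ κ₂ hbar hb h (Fb x) (m x)) x α = dZ K x α + lower (M x κ₁) α ∧
      dZt (fun x => K x - hbar / (4 * Real.pi * Complex.I) *
        action κ₁ κ₂ hbar hb h (Fb x) (m x)) x α = dZt K x α - lower (M x κ₂) α := by
    intro x hx α
    simp only [dZ, dZt, hval x hx, hsq, hsq0]
    constructor <;> ring
  have hlow : ∀ a b : Spinor, ∀ α, lower (fun β => a β + b β) α = lower a α + lower b α := by
    intro a b α
    fin_cases α <;> simp [lower]; ring
  have hkahler := hF.isKahlerPotential (hhb.add hh) hU hκ d.curve_left d.curve_right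
    (fun x hx => (hder x hx).differentiableAt.differentiableWithinAt)
    (fun x hx α => by
      rw [(hfirst x hx α).1, hK.deriv_z x hx, ← hlow]
      congr 1; funext β
      rw [d.del_curve hx d.left_ne_zero (by rw [l11, mul_zero]), l11, l12, l21]
      ring)
    (fun x hx α => by
      rw [(hfirst x hx α).2, hK.deriv_zt x hx, ← neg_add', ← hlow]
      congr 2; funext β
      rw [d.del_curve hx d.right_ne_zero (by rw [l22, zero_mul]), l22, l12, l21]
      ring)
  exact ⟨hkahler, hfirst, fun Ω' hΩ' => hkahler.exists_eq_add hU hUc hΩ'⟩
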